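/- Let $\ell\ge 0$, $m$ and $d$ be integers with $2m\ge d\ge 2$. Let $\sigma$ be the surface measure of the unit sphere $\mathbb S^{d-1}\subset\mathbb R^d$, let $\sigma_d=\sigma(\mathbb S^{d-1})$, and give $L^2(\mathbb S^{d-1})$ (real-valued functions) the inner product $[f,g]=\frac1{\sigma_d}\int_{\mathbb S^{d-1}} fg\,d\sigma$. For $n\ge 0$ let $\mathcal H^d_n$ be the space of restrictions to $\mathbb S^{d-1}$ of real harmonic polynomials on $\mathbb R^d$ homogeneous of degree $n$, let $N_{d,n}=\dim\mathcal H^d_n$, and let $\{Y^n_j: 1\le j\le N_{d,n}\}$ be any orthonormal basis of $\mathcal H^d_n$. For $f\in L^2(\mathbb S^{d-1})$ write $a_{nj}(f)=[f,Y^n_j]$. Let $\mathcal F^d_m$ be the space of all $f\in L^2(\mathbb S^{d-1})$ with $$\sum_{n=1}^\infty [n(n+d-2)]^m\sum_{j=1}^{N_{d,n}} a_{nj}(f)^2<\infty ,$$ let $\mathcal F^{d,\ell}_m=\{f\in\mathcal F^d_m: a_{nj}(f)=0 \text{ for all } 0\le n\le \ell,\ 1\le j\le N_{d,n}\}$, and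 set $$(f,g)_{m,\ell}=\sum_{n=\ell+1}^\infty [n(n+d-2)]^m\sum_{j=1}^{N_{d,n}} a_{nj}(f)\,a_{nj}(g)\qquad (f,g\in\mathcal F^d_m),$$ $$K_{d,m,\ell}(x,y)=\sum_{n=\ell+1}^\infty [n(n+d-2)]^{-m}\sum_{j=1}^{N_{d,n}} Y^n_j(x)\,Y^n_j(y)\qquad (x,y\in\mathbb S^{d-1}).$$ Let $\mathcal H_0=\mathcal H^d_0+\dots+\mathcal H^d_\ell$. Then the following hold. 1. Every $f\in\mathcal F^d_m$ has a unique continuous representative (so that $\mathcal F^d_m$ is regarded as a subspace of $C(\mathbb S^{d-1})$), and the series for $(f,g)_{m,\ell}$ and for $K_{d,m,\ell}(x,y)$ converge absolutely for all $f,g\in\mathcal F^d_m$ and all $x,y\in\mathbb S^{d-1}$. 2. $\mathcal H_0$ is the space of spherical polynomials of degree at most $\ell$, i.e. of restrictions to $\mathbb S^{d-1}$ of real polynomials on $\mathbb R^d$ of total degree at most $\ell$. 3. $K_{d,m,\ell}$ is the reproducing kernel of $\mathcal F^{d,\ell}_m$ with $(\cdot,\cdot)_{m,\ell}$: this is a Hilbert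 space, and for every $y\in\mathbb S^{d-1}$ one has $K_{d,m,\ell}(\cdot,y)\in\mathcal F^{d,\ell}_m$ and $(f,K_{d,m,\ell}(\cdot,y))_{m,\ell}=f(y)$ for all $f\in\mathcal F^{d,\ell}_m$. 4. $K_{d,m,\ell}$ is a semi-reproducing kernel for $\mathcal F^d_m$ with $(\cdot,\cdot)_{m,\ell}$, with respect to $\mathcal H_0$. That is: $(\cdot,\cdot)_{m,\ell}$ is a semi-inner product on $\mathcal F^d_m$ (symmetric, bilinear, positive semi-definite); its kernel $\{f\in\mathcal F^d_m:(f,f)_{m,\ell}=0\}$ is equal to $\mathcal H_0$ and is finite-dimensional; $\mathcal F^d_m$ is complete with respect to the semi-norm $\sqrt{(f,f)_{m,\ell}}$; $K_{d,m,\ell}$ is symmetric; and for all $n$, all distinct points $x_1,\dots,x_n\in\mathbb S^{d-1}$ and all $a_1,\dots,a_n\in\mathbb R$ such that $\sum_{j=1}^n a_jh(x_j)=0$ for every $h\in\mathcal H_0$, one has $$\sum_{j=1}^n a_jK_{d,m,\ell}(\cdot,x_j)\in\mathcal F^d_m \quad\text{and}\quad \Big(f,\sum_{i=1}^n a_iK_{d,m,\ell}(\cdot,x_i)\Big)_{m,\ell}=\sum_{j=1}^n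 a_jf(x_j)\quad\text{for all } f\in\mathcal F^d_m .$$ -/

import Mathlib

noncomputable section

namespace SphereSpline

open MeasureTheory Filter Topology

/-! ## Semi-Hilbert spaces of continuous functions and semi-reproducing kernels -/

section SemiHilbert

/-- `ip` restricts to a (real) semi-inner product on the space `H`: symmetric, bilinear and
positive semi-definite on `H`. -/
structure IsSemiInnerProduct {D : Type*} [TopologicalSpace D] (H : Submodule ℝ C(D, ℝ))
    (ip : C(D, ℝ) → C(D, ℝ) → ℝ) : Prop where
  symm : ∀ f ∈ H, ∀ g ∈ H, ip f g = ip g f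
  add_left : ∀ f ∈ H, ∀ g ∈ H, ∀ h ∈ H, ip (f + g) h = ip f h + ip g h
  smul_left : ∀ c : ℝ, ∀ f ∈ H, ∀ g ∈ H, ip (c • f) g = c * ip f g
  nonneg : ∀ f ∈ H, 0 ≤ ip f f

/-- The semi-norm induced by `ip`. -/
def semiNorm {D : Type*} [TopologicalSpace D] (ip : C(D, ℝ) → C(D, ℝ) → ℝ) (f : C(D, ℝ)) : ℝ :=
  Real.sqrt (ip f f)

/-- `H ⊆ C(D)` with `ip` is a semi-Hilbert space whose semi-inner product has the
finite-dimensional kernel `H₀ = {f ∈ H | (f, f) = 0}`, and which is complete for the induced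
semi-norm. -/
structure IsSemiHilbert {D : Type*} [TopologicalSpace D] (H : Submodule ℝ C(D, ℝ))
    (ip : C(D, ℝ) → C(D, ℝ) → ℝ) (H₀ : Submodule ℝ C(D, ℝ)) : Prop where
  semiInner : IsSemiInnerProduct H ip
  mem_kernel_iff : ∀ f, f ∈ H₀ ↔ f ∈ H ∧ ip f f = 0
  finite_kernel : Module.Finite ℝ H₀
  complete : ∀ u : ℕ → C(D, ℝ), (∀ k, u k ∈ H) →
    (∀ ε > 0, ∃ N, ∀ p ≥ N, ∀ q ≥ N, semiNorm ip (u p - u q) < ε) →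
    ∃ f ∈ H, Tendsto (fun k => semiNorm ip (u k - f)) atTop (𝓝 0)

/-- `(x, a)`, with the points `x j` distinct, is an `H₀`-increment: the functional
`f ↦ ∑ j, a j * f (x j)` vanishes on `H₀`. -/
def IsIncrement {D : Type*} [TopologicalSpace D] (H₀ : Submodule ℝ C(D, ℝ)) {n : ℕ}
    (x : Fin n → D) (a : Fin n → ℝ) : Prop :=
  Function.Injective x ∧ ∀ f ∈ H₀, ∑ j, a j * f (x j) = 0

/-- `K` is a semi-reproducing kernel for the semi-Hilbert space `(H, ip)` with kernel `H₀`. -/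
structure IsSemiReproducingKernel {D : Type*} [TopologicalSpace D] (H : Submodule ℝ C(D, ℝ))
    (ip : C(D, ℝ) → C(D, ℝ) → ℝ) (H₀ : Submodule ℝ C(D, ℝ)) (K : D → D → ℝ) : Prop where
  semiHilbert : IsSemiHilbert H ip H₀
  symm : ∀ x y, K x y = K y x
  /-- For each increment, the function `∑ j, a j K(·, x j)` belongs to `H` and represents the
  increment functional on `H`. -/
  reproduces : ∀ (n : ℕ) (x : Fin n → D) (a : Fin n → ℝ), IsIncrement H₀ x a →
    ∃ g ∈ H, (∀ y, g y = ∑ j, a j * K y (x j)) ∧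
      ∀ f ∈ H, ip f g = ∑ j, a j * f (x j)

/-- `K` is the reproducing kernel of the Hilbert space `(H, ip)`. A semi-Hilbert space with
trivial kernel is a Hilbert space. -/
structure IsReproducingKernel {D : Type*} [TopologicalSpace D] (H : Submodule ℝ C(D, ℝ))
    (ip : C(D, ℝ) → C(D, ℝ) → ℝ) (K : D → D → ℝ) : Prop where
  hilbert : IsSemiHilbert H ip ⊥
  reproduces : ∀ y, ∃ k ∈ H, (∀ x, k x = K x y) ∧ ∀ f ∈ H, ip f k = f y

end SemiHilbert

/-! ## Spherical harmonics -/

/-- The unit sphere `𝕊^{d-1}` of `ℝ^d`. -/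
abbrev Sph (d : ℕ) : Type := Metric.sphere (0 : EuclideanSpace ℝ (Fin d)) 1

/-- The surface measure of the sphere divided by the total surface area. -/
def sphMeasure (d : ℕ) : Measure (Sph d) :=
  ((volume : Measure (EuclideanSpace ℝ (Fin d))).toSphere Set.univ)⁻¹ •
    (volume : Measure (EuclideanSpace ℝ (Fin d))).toSphere

instance sphMeasure_finite (d : ℕ) : IsFiniteMeasure (sphMeasure d) := by
  unfold sphMeasure
  infer_instance

/-- `L²(𝕊^{d-1})` with inner product `[f, g] = (1/σ_d) ∫ f g dσ`. -/
abbrev L2Sph (d : ℕ) : Type := Lp ℝ 2 (sphMeasure d)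

/-- The `L²` class of a continuous function on the sphere. -/
def toL2 (d : ℕ) : C(Sph d, ℝ) →L[ℝ] L2Sph d :=
  ContinuousMap.toLp 2 (sphMeasure d) ℝ

/-- Restriction of a polynomial on `ℝ^d` to the sphere. -/
def polyRestrict (d : ℕ) : MvPolynomial (Fin d) ℝ →ₗ[ℝ] C(Sph d, ℝ) where
  toFun p :=
    { toFun := fun x => MvPolynomial.eval (fun i => (x : EuclideanSpace ℝ (Fin d)) i) p
      continuous_toFun := (MvPolynomial.continuous_eval p).comp (by fun_prop) }
  map_add' p q := by ext x; simp
  map_smul' c p := by ext x; simp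

/-- The Laplacian `∑ i, ∂²/∂x_i²` on polynomials. -/
def polyLaplacian (d : ℕ) : MvPolynomial (Fin d) ℝ →ₗ[ℝ] MvPolynomial (Fin d) ℝ :=
  ∑ i : Fin d, (MvPolynomial.pderiv i).toLinearMap ∘ₗ (MvPolynomial.pderiv i).toLinearMap

/-- The space of spherical harmonics of degree `n`: restrictions to the sphere of the harmonic
polynomials homogeneous of degree `n`. -/
def sphHarm (d n : ℕ) : Submodule ℝ C(Sph d, ℝ) :=
  (MvPolynomial.homogeneousSubmodule (Fin d) ℝ n ⊓ LinearMap.ker (polyLaplacian d)).map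
    (polyRestrict d)

/-- The dimension of the space of spherical harmonics of degree `n`. -/
def harmDim (d n : ℕ) : ℕ := Module.finrank ℝ (sphHarm d n)

/-- The sum of the spaces of spherical harmonics of degrees `0, …, ℓ`. -/
def sphPoly (d ℓ : ℕ) : Submodule ℝ C(Sph d, ℝ) :=
  ⨆ n ∈ Finset.range (ℓ + 1), sphHarm d n

/-- For each `n`, the family `Y n` is an orthonormal basis of the space of spherical harmonics of
degree `n`, for the inner product of `L²(𝕊^{d-1})`. -/
structure IsHarmonicBasis (d : ℕ) (Y : (n : ℕ) → Fin (harmDim d n) → C(Sph d, ℝ)) : Prop where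
  orthonormal : ∀ n, Orthonormal ℝ fun j => toL2 d (Y n j)
  span_eq : ∀ n, Submodule.span ℝ (Set.range (Y n)) = sphHarm d n

/-! ## The energy spaces, the energy semi-inner product and the kernels -/

/-- The Fourier coefficient `a_{nj}` of `f`. -/
def coeff {d : ℕ} (Y : (n : ℕ) → Fin (harmDim d n) → C(Sph d, ℝ)) (f : L2Sph d) (n : ℕ)
    (j : Fin (harmDim d n)) : ℝ :=
  inner ℝ f (toL2 d (Y n j))

/-- `n (n + d - 2)`, the negative of the Laplace--Beltrami eigenvalue. -/
def eigen (d n : ℕ) : ℝ := (n : ℝ) * ((n : ℝ) + (d : ℝ) - 2)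

theorem coeff_add {d : ℕ} (Y : (n : ℕ) → Fin (harmDim d n) → C(Sph d, ℝ)) (f g : L2Sph d) (n : ℕ)
    (j : Fin (harmDim d n)) : coeff Y (f + g) n j = coeff Y f n j + coeff Y g n j :=
  inner_add_left _ _ _

theorem coeff_smul {d : ℕ} (Y : (n : ℕ) → Fin (harmDim d n) → C(Sph d, ℝ)) (c : ℝ) (f : L2Sph d)
    (n : ℕ) (j : Fin (harmDim d n)) : coeff Y (c • f) n j = c * coeff Y f n j :=
  real_inner_smul_left _ _ _

theorem eigen_nonneg (d : ℕ) (n : ℕ) (hn : 0 < n) (hd : 2 ≤ d) : 0 ≤ eigen d n := by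
  have h2 : (2 : ℝ) ≤ d := by exact_mod_cast hd
  have h1 : (0 : ℝ) < n := by exact_mod_cast hn
  unfold eigen
  exact mul_nonneg h1.le (by linarith)

/-- The space `F_m^d` of all `f ∈ L²(𝕊^{d-1})` with
`∑_{n ≥ 1} [n (n + d - 2)]^m ∑_j a_{nj}² < ∞`, for `d ≥ 2`. -/
def energySpaceL2 {d : ℕ} (hd : 2 ≤ d) (m : ℕ)
    (Y : (n : ℕ) → Fin (harmDim d n) → C(Sph d, ℝ)) : Submodule ℝ (L2Sph d) where
  carrier := {f | Summable fun n : Set.Ioi (0 : ℕ) =>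
    eigen d n ^ m * ∑ j, coeff Y f n j ^ 2}
  zero_mem' := by simp [coeff, summable_zero]
  add_mem' := by
    intro f g hf hg
    refine Summable.of_nonneg_of_le (fun n => ?_) (fun n => ?_) ((hf.add hg).mul_left 2)
    · exact mul_nonneg (pow_nonneg (eigen_nonneg d n n.2 hd) _)
        (Finset.sum_nonneg fun j _ => sq_nonneg _)
    · rw [← mul_add, mul_left_comm]
      refine mul_le_mul_of_nonneg_left ?_ (pow_nonneg (eigen_nonneg d n n.2 hd) _)
      rw [← Finset.sum_add_distrib, Finset.mul_sum]
      refine Finset.sum_le_sum fun j _ => ?_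
      rw [coeff_add]
      nlinarith [sq_nonneg (coeff Y f n j - coeff Y g n j)]
  smul_mem' := by
    intro c f hf
    refine (Summable.mul_left (c ^ 2) hf).congr fun n => ?_
    simp only [coeff_smul, mul_pow, ← Finset.mul_sum]
    ring

/-- `F_m^d` as a space of continuous functions. -/
def energySpace {d : ℕ} (hd : 2 ≤ d) (m : ℕ)
    (Y : (n : ℕ) → Fin (harmDim d n) → C(Sph d, ℝ)) : Submodule ℝ C(Sph d, ℝ) :=
  (energySpaceL2 hd m Y).comap (toL2 d).toLinearMap

/-- The subspace of the `f ∈ F_m^d` with `a_{nj} = 0` for all `n ≤ ℓ` and all `j`. -/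
def energySpaceTail {d : ℕ} (hd : 2 ≤ d) (m ℓ : ℕ)
    (Y : (n : ℕ) → Fin (harmDim d n) → C(Sph d, ℝ)) : Submodule ℝ C(Sph d, ℝ) where
  carrier := {f | f ∈ energySpace hd m Y ∧ ∀ n ≤ ℓ, ∀ j, coeff Y (toL2 d f) n j = 0}
  zero_mem' := ⟨Submodule.zero_mem _, by simp [coeff]⟩
  add_mem' := by
    rintro f g ⟨hf, hf'⟩ ⟨hg, hg'⟩
    refine ⟨Submodule.add_mem _ hf hg, fun n hn j => ?_⟩
    rw [map_add, coeff_add, hf' n hn, hg' n hn, add_zero]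
  smul_mem' := by
    rintro c f ⟨hf, hf'⟩
    refine ⟨Submodule.smul_mem _ c hf, fun n hn j => ?_⟩
    rw [map_smul, coeff_smul, hf' n hn, mul_zero]

/-- The `n`-th term of the energy semi-inner product. -/
def energyTerm {d : ℕ} (m : ℕ) (Y : (n : ℕ) → Fin (harmDim d n) → C(Sph d, ℝ))
    (f g : C(Sph d, ℝ)) (n : ℕ) : ℝ :=
  eigen d n ^ m * ∑ j, coeff Y (toL2 d f) n j * coeff Y (toL2 d g) n j

/-- The energy semi-inner product
`(f, g)_{m,ℓ} = ∑_{n > ℓ} [n (n + d - 2)]^m ∑_j a_{nj} b_{nj}`. -/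
def energyInner {d : ℕ} (m ℓ : ℕ) (Y : (n : ℕ) → Fin (harmDim d n) → C(Sph d, ℝ))
    (f g : C(Sph d, ℝ)) : ℝ :=
  ∑' n : Set.Ioi ℓ, energyTerm m Y f g n

/-- The `n`-th term of the kernel series. -/
def kernelTerm {d : ℕ} (m : ℕ) (Y : (n : ℕ) → Fin (harmDim d n) → C(Sph d, ℝ))
    (x y : Sph d) (n : ℕ) : ℝ :=
  (eigen d n ^ m)⁻¹ * ∑ j, Y n j x * Y n j y

/-- The kernel `K_{d,m,ℓ}(x, y) = ∑_{n > ℓ} [n (n + d - 2)]^{-m} ∑_j Y_j^n(x) Y_j^n(y)`. -/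
def splineKernel {d : ℕ} (m ℓ : ℕ) (Y : (n : ℕ) → Fin (harmDim d n) → C(Sph d, ℝ))
    (x y : Sph d) : ℝ :=
  ∑' n : Set.Ioi ℓ, kernelTerm m Y x y n

end SphereSpline

end

noncomputable section

namespace SphereSpline

open MeasureTheory Filter Topology

/-! ## The surface measure -/

/-! Everything reduces to the summability of `N_{d,n} / [n(n+d-2)]^m`. Since `N_{d,n} = O(n^(d-2))`
(`harmDim_le`) and the weight is at least `n^(2m) ≥ n^d`, the terms are `O(n^(-2))`
(`summable_harmDim`).

Three classical facts make the Fourier expansion usable. Harmonics of different degrees are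
orthogonal (`inner_sphHarm`), because the sum of the squared angular derivatives is symmetric and
has eigenvalues distinct for distinct degrees. Every polynomial restricts to a sum of harmonics of
no larger degree (`sphPoly_eq_map`), so by Stone–Weierstrass the harmonics are complete in L²
(`eq_zero_of_coeff`). Finally `∑ j, Y n j x ^ 2` equals `N_{d,n}` at every point (`sum_sq_basis`),
by rotation invariance.

By Cauchy–Schwarz, the degree-`n` block with coefficients `b` then has sup norm at most `√(N_{d,n} ∑
b²)`, so finite energy forces normal convergence in `C(𝕊^{d-1})` (`exists_continuous_of_coeff`).
This gives continuous representatives, and it turns completeness of the energy space into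
completeness of a Hilbert sum of Euclidean spaces (`exists_limit_energySpace`).

The function `K(·, y)` has coefficients `[n(n+d-2)]^{-m} Y n j y` in degrees above `ℓ`. Pairing it
with `f` therefore cancels the weights and returns `f(y)` minus the value at `y` of the projection
of `f` to degrees at most `ℓ` (`exists_kernel_section`). The projection is zero on the tail space,
and it is annihilated by increments; these are the two reproducing properties. -/

theorem toSphere_univ_ne_zero {d : ℕ} (hd : 2 ≤ d) :
    (volume : Measure (EuclideanSpace ℝ (Fin d))).toSphere Set.univ ≠ 0 := by
  have : Nonempty (Fin d) := ⟨⟨0, by omega⟩⟩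
  have := Measure.toSphere_ne_zero (volume : Measure (EuclideanSpace ℝ (Fin d)))
  rwa [Ne, Measure.measure_univ_eq_zero]

theorem isProbabilityMeasure_sphMeasure {d : ℕ} (hd : 2 ≤ d) :
    IsProbabilityMeasure (sphMeasure d) := by
  refine ⟨?_⟩
  rw [sphMeasure, Measure.smul_apply, smul_eq_mul]
  exact ENNReal.inv_mul_cancel (toSphere_univ_ne_zero hd) (measure_ne_top _ _)

theorem isOpenPosMeasure_sphMeasure {d : ℕ} :
    (sphMeasure d).IsOpenPosMeasure :=
  Measure.isOpenPosMeasure_smul _ (ENNReal.inv_ne_zero.2 (measure_ne_top _ _))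

/-- The action of a linear isometry on the sphere. -/
def sphMap {d : ℕ} (R : EuclideanSpace ℝ (Fin d) ≃ₗᵢ[ℝ] EuclideanSpace ℝ (Fin d)) :
    C(Sph d, Sph d) where
  toFun x := ⟨R x, by simp⟩
  continuous_toFun := by fun_prop

@[simp]
theorem coe_sphMap {d : ℕ} (R : EuclideanSpace ℝ (Fin d) ≃ₗᵢ[ℝ] EuclideanSpace ℝ (Fin d))
    (x : Sph d) : (sphMap R x : EuclideanSpace ℝ (Fin d)) = R x := rfl

-- The surface measure of a set is proportional to the Lebesgue measure of the cone over it in the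
-- unit ball, and a linear isometry carries cones to cones and preserves volume.
open scoped Pointwise in
theorem measurePreserving_sphMap {d : ℕ}
    (R : EuclideanSpace ℝ (Fin d) ≃ₗᵢ[ℝ] EuclideanSpace ℝ (Fin d)) :
    MeasurePreserving (sphMap R) (sphMeasure d) (sphMeasure d) := by
  refine MeasurePreserving.smul_measure ⟨(sphMap R).continuous.measurable, ?_⟩ _
  ext s hs
  have hs' := (sphMap R).continuous.measurable hs
  rw [Measure.map_apply (sphMap R).continuous.measurable hs, Measure.toSphere_apply' _ hs',
    Measure.toSphere_apply' _ hs]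
  congr 1
  have key : Set.Ioo (0 : ℝ) 1 • ((↑) '' (sphMap R ⁻¹' s) : Set (EuclideanSpace ℝ (Fin d))) =
      R ⁻¹' (Set.Ioo (0 : ℝ) 1 • ((↑) '' s)) := by
    ext x
    simp only [Set.mem_smul, Set.mem_preimage, Set.mem_image]
    constructor
    · rintro ⟨r, hr, _, ⟨y, hy, rfl⟩, rfl⟩
      exact ⟨r, hr, R y, ⟨_, hy, rfl⟩, by simp⟩
    · rintro ⟨r, hr, _, ⟨y, hy, rfl⟩, h⟩
      refine ⟨r, hr, R.symm y, ⟨sphMap R.symm y, ?_, rfl⟩, ?_⟩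
      · have : sphMap R (sphMap R.symm y) = y := Subtype.ext (by simp)
        simpa [this] using hy
      · apply R.injective
        simpa using h
  rw [key]
  exact R.measurePreserving.measure_preimage_equiv (f := R.toHomeomorph.toMeasurableEquiv) _

theorem integral_comp_sphMap {d : ℕ}
    (R : EuclideanSpace ℝ (Fin d) ≃ₗᵢ[ℝ] EuclideanSpace ℝ (Fin d)) (f : C(Sph d, ℝ)) :
    ∫ x, f (sphMap R x) ∂sphMeasure d = ∫ x, f x ∂sphMeasure d := by
  have h := (measurePreserving_sphMap R)
  rw [← integral_map (f := f) h.measurable.aemeasurable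
    f.continuous.aestronglyMeasurable, h.map_eq]

theorem integrable_continuousMap {d : ℕ} (f : C(Sph d, ℝ)) : Integrable f (sphMeasure d) :=
  f.continuous.integrable_of_hasCompactSupport (HasCompactSupport.of_compactSpace f)

theorem inner_toL2 {d : ℕ} (f g : C(Sph d, ℝ)) :
    inner ℝ (toL2 d f) (toL2 d g) = ∫ x, f x * g x ∂sphMeasure d := by
  rw [toL2, ContinuousMap.inner_toLp]
  simp [mul_comm]

theorem toL2_injective {d : ℕ} : Function.Injective (toL2 d) :=
  have := isOpenPosMeasure_sphMeasure (d := d)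
  ContinuousMap.toLp_injective _

/-! ## The angular derivatives -/

theorem hasDerivAt_eval {d : ℕ} (p : MvPolynomial (Fin d) ℝ) {c c' : ℝ → Fin d → ℝ} {t : ℝ}
    (hc : ∀ i, HasDerivAt (fun s => c s i) (c' t i) t) :
    HasDerivAt (fun s => MvPolynomial.eval (c s) p)
      (∑ i, c' t i * MvPolynomial.eval (c t) (MvPolynomial.pderiv i p)) t := by
  induction p using MvPolynomial.induction_on with
  | C a => simpa using hasDerivAt_const t a
  | add p q hp hq =>
    simpa [mul_add, Finset.sum_add_distrib] using hp.fun_add hq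
  | mul_X p i hp =>
    have := hp.fun_mul (hc i)
    simp only [map_mul, MvPolynomial.eval_X]
    refine this.congr_deriv ?_
    symm
    simp only [Derivation.leibniz, MvPolynomial.pderiv_X, smul_eq_mul, map_add, map_mul,
      MvPolynomial.eval_X, mul_add, Finset.sum_add_distrib]
    rw [add_comm, Finset.sum_mul]
    congr 1
    · exact Finset.sum_congr rfl fun j _ => by ring
    · rw [Finset.sum_eq_single i]
      · simp; ring
      · intro j _ hj
        simp [hj.symm]
      · simp

/-- The angular derivative `x_i ∂_j - x_j ∂_i`. -/
def angular {d : ℕ} (i j : Fin d) :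
    Derivation ℝ (MvPolynomial (Fin d) ℝ) (MvPolynomial (Fin d) ℝ) :=
  (MvPolynomial.X i : MvPolynomial (Fin d) ℝ) • MvPolynomial.pderiv j -
    (MvPolynomial.X j : MvPolynomial (Fin d) ℝ) • MvPolynomial.pderiv i

theorem angular_apply {d : ℕ} (i j : Fin d) (p : MvPolynomial (Fin d) ℝ) :
    angular i j p = MvPolynomial.X i * MvPolynomial.pderiv j p -
      MvPolynomial.X j * MvPolynomial.pderiv i p := rfl

@[simp]
theorem polyRestrict_apply {d : ℕ} (p : MvPolynomial (Fin d) ℝ) (x : Sph d) :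
    polyRestrict d p x = MvPolynomial.eval (fun i => (x : EuclideanSpace ℝ (Fin d)) i) p := rfl

theorem polyRestrict_mul {d : ℕ} (p q : MvPolynomial (Fin d) ℝ) :
    polyRestrict d (p * q) = polyRestrict d p * polyRestrict d q := by
  ext x; simp

/-- The generator of the rotations in the plane of the `i`-th and `j`-th coordinates. -/
def rotGen {d : ℕ} (i j : Fin d) : EuclideanSpace ℝ (Fin d) →L[ℝ] EuclideanSpace ℝ (Fin d) :=
  (EuclideanSpace.proj i : EuclideanSpace ℝ (Fin d) →L[ℝ] ℝ).smulRight
      (EuclideanSpace.single j 1) -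
    (EuclideanSpace.proj j : EuclideanSpace ℝ (Fin d) →L[ℝ] ℝ).smulRight
      (EuclideanSpace.single i 1)

theorem rotGen_mem_skewAdjoint {d : ℕ} (i j : Fin d) :
    rotGen i j ∈ skewAdjoint (EuclideanSpace ℝ (Fin d) →L[ℝ] EuclideanSpace ℝ (Fin d)) := by
  rw [skewAdjoint.mem_iff, ContinuousLinearMap.star_eq_adjoint, eq_comm,
    ContinuousLinearMap.eq_adjoint_iff]
  intro x y
  simp [rotGen, inner_sub_left, inner_sub_right, real_inner_smul_left, real_inner_smul_right,
    EuclideanSpace.inner_single_left, EuclideanSpace.inner_single_right]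
  ring

/-- The rotation by the angle `t` in the plane of the `i`-th and `j`-th coordinates. -/
def rot {d : ℕ} (i j : Fin d) (t : ℝ) :
    EuclideanSpace ℝ (Fin d) ≃ₗᵢ[ℝ] EuclideanSpace ℝ (Fin d) :=
  Unitary.linearIsometryEquiv ⟨NormedSpace.exp (t • rotGen i j), by
    let _ := NormedAlgebra.restrictScalars ℚ ℝ
      (EuclideanSpace ℝ (Fin d) →L[ℝ] EuclideanSpace ℝ (Fin d))
    exact NormedSpace.exp_mem_unitary_of_mem_skewAdjoint
      (skewAdjoint.smul_mem t (rotGen_mem_skewAdjoint i j))⟩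

theorem rot_apply {d : ℕ} (i j : Fin d) (t : ℝ) (x : EuclideanSpace ℝ (Fin d)) :
    rot i j t x = NormedSpace.exp (t • rotGen i j) x := rfl

theorem hasDerivAt_rot {d : ℕ} (i j : Fin d) (t : ℝ) (x : EuclideanSpace ℝ (Fin d)) :
    HasDerivAt (fun s => rot i j s x) (rotGen i j (rot i j t x)) t := by
  simp only [rot_apply]
  have h := hasDerivAt_exp_smul_const' (𝕂 := ℝ) (rotGen i j) t
  exact h.clm_apply (hasDerivAt_const t x) |>.congr_deriv (by simp)

theorem hasDerivAt_polyRestrict_rot {d : ℕ} (i j : Fin d) (p : MvPolynomial (Fin d) ℝ) (t : ℝ)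
    (x : Sph d) : HasDerivAt (fun s => polyRestrict d p (sphMap (rot i j s) x))
      (polyRestrict d (angular i j p) (sphMap (rot i j t) x)) t := by
  have h := hasDerivAt_rot i j t x
  have h' : ∀ k, HasDerivAt (fun s => rot i j s x k) (rotGen i j (rot i j t x) k) t := by
    intro k
    exact (EuclideanSpace.proj k : EuclideanSpace ℝ (Fin d) →L[ℝ] ℝ).hasFDerivAt.comp_hasDerivAt
      t h
  have := hasDerivAt_eval p (c := fun s k => rot i j s x k)
    (c' := fun s k => rotGen i j (rot i j s x) k) h'
  refine this.congr_deriv ?_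
  simp [angular_apply, rotGen, sub_mul, Finset.sum_sub_distrib]

/-- The angular derivative is the velocity of `p` along a one-parameter group of rotations, and
rotations do not change the integral; differentiate under the integral sign at time 0. -/
theorem integral_angular {d : ℕ} (i j : Fin d) (p : MvPolynomial (Fin d) ℝ) :
    ∫ x, polyRestrict d (angular i j p) x ∂sphMeasure d = 0 := by
  have h := hasDerivAt_integral_of_dominated_loc_of_deriv_le (μ := sphMeasure d) (s := Set.univ)
    (F := fun t x => polyRestrict d p (sphMap (rot i j t) x))
    (F' := fun t x => polyRestrict d (angular i j p) (sphMap (rot i j t) x))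
    (bound := fun _ => ‖polyRestrict d (angular i j p)‖) (x₀ := 0) univ_mem
    (Eventually.of_forall fun t => (integrable_continuousMap
      ((polyRestrict d p).comp (sphMap (rot i j t)))).aestronglyMeasurable)
    (integrable_continuousMap ((polyRestrict d p).comp (sphMap (rot i j 0))))
    (integrable_continuousMap
      ((polyRestrict d (angular i j p)).comp (sphMap (rot i j 0)))).aestronglyMeasurable
    (ae_of_all _ fun x t _ => ContinuousMap.norm_coe_le_norm _ _)
    (integrable_const _)
    (ae_of_all _ fun x t _ => hasDerivAt_polyRestrict_rot i j p t x)
  have h2 := h.2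
  -- Invariance makes the differentiated function of `t` constant.
  simp only [integral_comp_sphMap] at h2
  exact h2.unique (hasDerivAt_const _ _)

/-- Integration by parts on the sphere: apply `integral_angular` to the product and use the Leibniz
rule. -/
theorem inner_angular {d : ℕ} (i j : Fin d) (p q : MvPolynomial (Fin d) ℝ) :
    inner ℝ (toL2 d (polyRestrict d (angular i j p))) (toL2 d (polyRestrict d q)) =
      -inner ℝ (toL2 d (polyRestrict d p)) (toL2 d (polyRestrict d (angular i j q))) := by
  have h := integral_angular i j (p * q)
  rw [Derivation.leibniz, map_add, smul_eq_mul, smul_eq_mul, polyRestrict_mul,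
    polyRestrict_mul] at h
  simp only [ContinuousMap.add_apply] at h
  rw [integral_add (integrable_continuousMap (polyRestrict d p * polyRestrict d (angular i j q)))
    (integrable_continuousMap (polyRestrict d q * polyRestrict d (angular i j p)))] at h
  rw [inner_toL2, inner_toL2]
  simp only [ContinuousMap.mul_apply, mul_comm (polyRestrict d q _)] at h
  linarith

/-! ## The Laplacian on polynomials -/

theorem polyLaplacian_apply {d : ℕ} (p : MvPolynomial (Fin d) ℝ) :
    polyLaplacian d p = ∑ i, MvPolynomial.pderiv i (MvPolynomial.pderiv i p) := by
  simp [polyLaplacian, LinearMap.sum_apply]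

theorem isHomogeneous_polyLaplacian {d n : ℕ} {p : MvPolynomial (Fin d) ℝ}
    (hp : p.IsHomogeneous n) : (polyLaplacian d p).IsHomogeneous (n - 2) := by
  rw [polyLaplacian_apply]
  exact MvPolynomial.IsHomogeneous.sum _ _ _ fun i _ => hp.pderiv.pderiv

theorem polyLaplacian_eq_zero {d n : ℕ} {p : MvPolynomial (Fin d) ℝ}
    (hp : p.IsHomogeneous n) (hn : n < 2) : polyLaplacian d p = 0 := by
  rw [polyLaplacian_apply]
  refine Finset.sum_eq_zero fun i _ => ?_
  have h : (MvPolynomial.pderiv i p).IsHomogeneous 0 := by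
    have := hp.pderiv (i := i)
    rwa [show n - 1 = 0 by omega] at this
  rw [← MvPolynomial.totalDegree_zero_iff_isHomogeneous,
    MvPolynomial.totalDegree_eq_zero_iff_eq_C] at h
  rw [h, MvPolynomial.pderiv_C]

/-- The polynomial `|x|²`. -/
def normSqPoly (d : ℕ) : MvPolynomial (Fin d) ℝ := ∑ i, MvPolynomial.X i ^ 2

theorem isHomogeneous_normSqPoly (d : ℕ) : (normSqPoly d).IsHomogeneous 2 :=
  MvPolynomial.IsHomogeneous.sum _ _ _ fun i _ => by
    simpa using (MvPolynomial.isHomogeneous_X ℝ i).pow 2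

theorem polyRestrict_normSqPoly (d : ℕ) : polyRestrict d (normSqPoly d) = 1 := by
  ext x
  have h : ‖(x : EuclideanSpace ℝ (Fin d))‖ ^ 2 = 1 := by simp
  rw [EuclideanSpace.real_norm_sq_eq] at h
  simpa [normSqPoly] using h

/-- The polynomial form of the spherical Laplacian, obtained by Euler's identity for `p` and for its
first derivatives. The factors 2 appear because each coordinate plane is counted as `(i, j)` and as
`(j, i)`. -/
theorem sum_angular_angular {d n : ℕ} {p : MvPolynomial (Fin d) ℝ} (hp : p.IsHomogeneous n) :
    ∑ i, ∑ j, angular i j (angular i j p) =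
      2 * (normSqPoly d * polyLaplacian d p) - MvPolynomial.C (2 * eigen d n) * p := by
  have euler : ∑ i, MvPolynomial.X i * MvPolynomial.pderiv i p = MvPolynomial.C (n : ℝ) * p := by
    rw [hp.sum_X_mul_pderiv, nsmul_eq_mul, map_natCast]
  have euler2 : ∑ i, ∑ j, MvPolynomial.X i * (MvPolynomial.X j *
      MvPolynomial.pderiv j (MvPolynomial.pderiv i p)) =
      MvPolynomial.C ((n : ℝ) * (n - 1)) * p := by
    have : ∀ i, ∑ j, MvPolynomial.X i * (MvPolynomial.X j *
        MvPolynomial.pderiv j (MvPolynomial.pderiv i p)) =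
        MvPolynomial.C ((n : ℝ) - 1) * (MvPolynomial.X i * MvPolynomial.pderiv i p) := by
      intro i
      rw [← Finset.mul_sum, hp.pderiv.sum_X_mul_pderiv]
      -- In degree 0 the truncated `n - 1` differs from the real one, but there `p` is constant and
      -- both sides vanish.
      rcases n with _ | n
      · have h := hp
        rw [← MvPolynomial.totalDegree_zero_iff_isHomogeneous,
          MvPolynomial.totalDegree_eq_zero_iff_eq_C] at h
        rw [h]; simp
      · simp; ring
    rw [Finset.sum_congr rfl fun i _ => this i, ← Finset.mul_sum, euler, ← mul_assoc, ← map_mul,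
      mul_comm]
    ring_nf
  have expand : ∀ i j, angular i j (angular i j p) =
      (if i = j then MvPolynomial.X i * MvPolynomial.pderiv j p else 0)
      + MvPolynomial.X i ^ 2 * MvPolynomial.pderiv j (MvPolynomial.pderiv j p)
      - MvPolynomial.X i * MvPolynomial.pderiv i p
      - MvPolynomial.X i * (MvPolynomial.X j * MvPolynomial.pderiv j (MvPolynomial.pderiv i p))
      + ((if j = i then MvPolynomial.X j * MvPolynomial.pderiv i p else 0)
      + MvPolynomial.X j ^ 2 * MvPolynomial.pderiv i (MvPolynomial.pderiv i p)
      - MvPolynomial.X j * MvPolynomial.pderiv j p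
      - MvPolynomial.X j * (MvPolynomial.X i * MvPolynomial.pderiv i
        (MvPolynomial.pderiv j p))) := by
    intro i j
    by_cases hij : i = j
    · subst hij
      simp [angular_apply]; ring
    · have hji : j ≠ i := fun h => hij h.symm
      simp [angular_apply, MvPolynomial.pderiv_X, hij, hji]
      ring
  -- The expansion has two groups of terms exchanged by `i ↔ j`. Each sums to `|x|²Δp + (n - dn -
  -- n(n-1)) p`, and the bracket is `-n(n+d-2)`.
  have half : ∑ i : Fin d, ∑ j : Fin d,
      ((if i = j then MvPolynomial.X i * MvPolynomial.pderiv j p else 0)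
      + MvPolynomial.X i ^ 2 * MvPolynomial.pderiv j (MvPolynomial.pderiv j p)
      - MvPolynomial.X i * MvPolynomial.pderiv i p
      - MvPolynomial.X i * (MvPolynomial.X j * MvPolynomial.pderiv j (MvPolynomial.pderiv i p)))
      = normSqPoly d * polyLaplacian d p - MvPolynomial.C (eigen d n) * p := by
    simp only [Finset.sum_sub_distrib, Finset.sum_add_distrib]
    rw [euler2, polyLaplacian_apply, normSqPoly, Finset.sum_mul_sum]
    simp only [Finset.sum_ite_eq, Finset.mem_univ, if_true, Finset.sum_const, Finset.card_univ,
      Fintype.card_fin, ← Finset.smul_sum]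
    rw [euler, eigen, nsmul_eq_mul]
    simp only [map_mul, map_sub, map_add, map_natCast, map_one, map_ofNat]
    ring
  rw [Finset.sum_congr rfl fun i _ => Finset.sum_congr rfl fun j _ => expand i j]
  have half' := half
  rw [Finset.sum_comm] at half'
  rw [Finset.sum_congr rfl fun i _ => Finset.sum_add_distrib, Finset.sum_add_distrib, half, half']
  simp only [map_mul, map_ofNat]
  ring

/-! ## Orthogonal substitutions -/

/-- Composition of a polynomial with a linear map. -/
def linSubst {d : ℕ} (R : EuclideanSpace ℝ (Fin d) ≃ₗᵢ[ℝ] EuclideanSpace ℝ (Fin d)) :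
    MvPolynomial (Fin d) ℝ →ₐ[ℝ] MvPolynomial (Fin d) ℝ :=
  MvPolynomial.aeval fun k =>
    ∑ i, MvPolynomial.C (R (EuclideanSpace.single i 1) k) * MvPolynomial.X i

theorem polyRestrict_linSubst {d : ℕ}
    (R : EuclideanSpace ℝ (Fin d) ≃ₗᵢ[ℝ] EuclideanSpace ℝ (Fin d))
    (p : MvPolynomial (Fin d) ℝ) :
    polyRestrict d (linSubst R p) = (polyRestrict d p).comp (sphMap R) := by
  ext x
  induction p using MvPolynomial.induction_on with
  | C a => simp [linSubst]
  | add p q hp hq => simpa using congrArg₂ (· + ·) hp hq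
  | mul_X p k hp =>
    have hx : R x k = ∑ i, R (EuclideanSpace.single i 1) k * (x : EuclideanSpace ℝ (Fin d)) i := by
      have : (x : EuclideanSpace ℝ (Fin d)) =
          ∑ i, (x : EuclideanSpace ℝ (Fin d)) i • EuclideanSpace.single i (1 : ℝ) := by
        simpa using ((EuclideanSpace.basisFun (Fin d) ℝ).sum_repr
          (x : EuclideanSpace ℝ (Fin d))).symm
      conv_lhs => rw [this]
      simp [mul_comm]
    simp only [polyRestrict_apply, ContinuousMap.comp_apply, coe_sphMap] at hp
    rw [map_mul, polyRestrict_apply, map_mul, hp]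
    simp [hx, linSubst]

theorem isHomogeneous_linSubst {d n : ℕ}
    (R : EuclideanSpace ℝ (Fin d) ≃ₗᵢ[ℝ] EuclideanSpace ℝ (Fin d))
    {p : MvPolynomial (Fin d) ℝ} (hp : p.IsHomogeneous n) : (linSubst R p).IsHomogeneous n := by
  have := hp.aeval (fun k => ∑ i, MvPolynomial.C (R (EuclideanSpace.single i 1) k) *
    (MvPolynomial.X i : MvPolynomial (Fin d) ℝ)) (n := 1) fun k =>
      MvPolynomial.IsHomogeneous.sum _ _ _ fun i _ => (MvPolynomial.isHomogeneous_X ℝ i).C_mul _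
  simpa [linSubst] using this

theorem pderiv_linSubst {d : ℕ}
    (R : EuclideanSpace ℝ (Fin d) ≃ₗᵢ[ℝ] EuclideanSpace ℝ (Fin d))
    (p : MvPolynomial (Fin d) ℝ) (i : Fin d) :
    MvPolynomial.pderiv i (linSubst R p) = ∑ k, MvPolynomial.C (R (EuclideanSpace.single i 1) k) *
      linSubst R (MvPolynomial.pderiv k p) := by
  induction p using MvPolynomial.induction_on with
  | C a => simp [linSubst]
  | add p q hp hq => simp [hp, hq, mul_add, Finset.sum_add_distrib]
  | mul_X p k hp =>
    have hX : MvPolynomial.pderiv i (linSubst R (MvPolynomial.X k)) =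
        MvPolynomial.C (R (EuclideanSpace.single i 1) k) := by
      simp [linSubst, MvPolynomial.pderiv_X, Pi.single_apply]
    have hterm : ∀ j, linSubst R (MvPolynomial.pderiv j (p * MvPolynomial.X k)) =
        linSubst R p * (if j = k then 1 else 0) +
          linSubst R (MvPolynomial.X k) * linSubst R (MvPolynomial.pderiv j p) := by
      intro j
      by_cases hj : j = k
      · subst hj; simp
      · simp [MvPolynomial.pderiv_X_of_ne (Ne.symm hj), hj]
    have hsum : ∀ (a b : MvPolynomial (Fin d) ℝ) (u v : Fin d → MvPolynomial (Fin d) ℝ),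
        a * u k + b * ∑ j, u j * v j =
          ∑ j, u j * (a * (if j = k then 1 else 0) + b * v j) := by
      intro a b u v
      simp only [mul_add, Finset.sum_add_distrib, Finset.mul_sum]
      congr 1
      · simp [mul_comm]
      · exact Finset.sum_congr rfl fun j _ => mul_left_comm _ _ _
    calc MvPolynomial.pderiv i (linSubst R (p * MvPolynomial.X k))
        = linSubst R p * MvPolynomial.C (R (EuclideanSpace.single i 1) k) +
            linSubst R (MvPolynomial.X k) * ∑ j, MvPolynomial.C (R (EuclideanSpace.single i 1) j) *
              linSubst R (MvPolynomial.pderiv j p) := by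
          rw [map_mul, Derivation.leibniz, hp, hX, smul_eq_mul, smul_eq_mul]
      _ = ∑ j, MvPolynomial.C (R (EuclideanSpace.single i 1) j) *
            (linSubst R p * (if j = k then 1 else 0) +
              linSubst R (MvPolynomial.X k) * linSubst R (MvPolynomial.pderiv j p)) := by
          exact hsum _ _ (fun j => MvPolynomial.C (R (EuclideanSpace.single i 1) j)) _
      _ = _ := Finset.sum_congr rfl fun j _ => by rw [hterm]

/-- The inverse of an isometry is its transpose, so the rows of its matrix are orthonormal. This is
what makes the Laplacian commute with orthogonal substitutions. -/
theorem sum_single_mul_single {d : ℕ}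
    (R : EuclideanSpace ℝ (Fin d) ≃ₗᵢ[ℝ] EuclideanSpace ℝ (Fin d)) (k l : Fin d) :
    ∑ i, R (EuclideanSpace.single i 1) k * R (EuclideanSpace.single i 1) l =
      if k = l then 1 else 0 := by
  have h : ∀ i k, R (EuclideanSpace.single i 1) k = R.symm (EuclideanSpace.single k 1) i := by
    intro i k
    have := R.inner_map_eq_flip (EuclideanSpace.single i 1) (EuclideanSpace.single k 1)
    simpa [EuclideanSpace.inner_single_left, EuclideanSpace.inner_single_right] using this
  have := R.symm.inner_map_map (EuclideanSpace.single k 1) (EuclideanSpace.single l 1)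
  rw [PiLp.inner_apply] at this
  simp only [h]
  simpa [EuclideanSpace.inner_single_left, Pi.single_apply, mul_comm, eq_comm] using this

theorem polyLaplacian_linSubst {d : ℕ}
    (R : EuclideanSpace ℝ (Fin d) ≃ₗᵢ[ℝ] EuclideanSpace ℝ (Fin d))
    (p : MvPolynomial (Fin d) ℝ) :
    polyLaplacian d (linSubst R p) = linSubst R (polyLaplacian d p) := by
  simp only [polyLaplacian_apply, pderiv_linSubst, map_sum, MvPolynomial.pderiv_C_mul]
  simp only [Finset.mul_sum]
  rw [Finset.sum_comm]
  refine Finset.sum_congr rfl fun k _ => ?_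
  rw [Finset.sum_comm]
  have : ∀ l, ∑ i, MvPolynomial.C (R (EuclideanSpace.single i 1) k) *
      (MvPolynomial.C (R (EuclideanSpace.single i 1) l) *
        linSubst R (MvPolynomial.pderiv l (MvPolynomial.pderiv k p))) =
      MvPolynomial.C (if k = l then 1 else 0) *
        linSubst R (MvPolynomial.pderiv l (MvPolynomial.pderiv k p)) := by
    intro l
    rw [← sum_single_mul_single R k l, map_sum, Finset.sum_mul]
    simp only [map_mul, mul_assoc]
  rw [Finset.sum_congr rfl fun l _ => this l, Finset.sum_eq_single k]
  · simp
  · intro l _ hl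
    simp [hl.symm]
  · simp

theorem comp_sphMap_mem_sphHarm {d n : ℕ}
    (R : EuclideanSpace ℝ (Fin d) ≃ₗᵢ[ℝ] EuclideanSpace ℝ (Fin d)) {f : C(Sph d, ℝ)}
    (hf : f ∈ sphHarm d n) : f.comp (sphMap R) ∈ sphHarm d n := by
  obtain ⟨p, ⟨hp, hp'⟩, rfl⟩ := hf
  refine ⟨linSubst R p, ⟨isHomogeneous_linSubst R hp, ?_⟩, polyRestrict_linSubst R p⟩
  rw [SetLike.mem_coe, LinearMap.mem_ker] at hp' ⊢
  rw [polyLaplacian_linSubst, hp', map_zero]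

/-! ## The dimension of the space of spherical harmonics -/

/-- The equation `∂₀²p = -∑_{i≠0} ∂ᵢ²p` is a recursion in the exponent of the variable 0: the Cauchy
data, of exponents 0 and 1, determine `p`. -/
theorem eq_zero_of_coeff_eq_zero {e : ℕ} {p : MvPolynomial (Fin (e + 1)) ℝ}
    (hp : polyLaplacian (e + 1) p = 0) (h0 : ∀ s, s 0 ≤ 1 → p.coeff s = 0) : p = 0 := by
  have key : ∀ k, ∀ s : Fin (e + 1) →₀ ℕ, s 0 = k → p.coeff s = 0 := by
    intro k
    induction k using Nat.strong_induction_on with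
    | _ k ih =>
      intro s hs
      by_cases hk : k ≤ 1
      · exact h0 s (hs ▸ hk)
      obtain ⟨t, rfl⟩ : ∃ t, s = t + Finsupp.single 0 2 :=
        ⟨s - Finsupp.single 0 2, (tsub_add_cancel_of_le (by
          rw [Finsupp.single_le_iff]; omega)).symm⟩
      have hc := congrArg (MvPolynomial.coeff t) hp
      rw [polyLaplacian_apply, MvPolynomial.coeff_sum, Fin.sum_univ_succ] at hc
      simp only [MvPolynomial.coeff_pderiv, MvPolynomial.coeff_zero] at hc
      rw [Finset.sum_eq_zero, add_zero] at hc
      · rw [add_assoc, ← Finsupp.single_add, one_add_one_eq_two] at hc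
        simp only [Finsupp.coe_add, Pi.add_apply, Finsupp.single_eq_same, Nat.cast_add,
          Nat.cast_one] at hc
        rw [mul_assoc] at hc
        exact (mul_eq_zero.1 hc).resolve_right (by positivity)
      -- The other second derivatives involve coefficients whose exponent at 0 is `k - 2`.
      · intro i _
        rw [ih (k - 2) (by omega) _ (by
          simp [Fin.succ_ne_zero] at hs ⊢; omega)]
        simp
  ext s
  simpa using key _ s rfl

/-- The exponents of degree `n` with first entry at most `1`. -/
def reducedExponents (e n : ℕ) : Finset (Fin (e + 2) →₀ ℕ) :=
  {s ∈ Finset.univ.finsuppAntidiag n | s 0 ≤ 1}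

theorem card_reducedExponents_le (e n : ℕ) :
    (reducedExponents e n).card ≤ 2 * (n + 1) ^ e := by
  -- The last exponent is dropped, since the total degree recovers it. The reductions modulo 2 and
  -- `n + 1` lose nothing on `reducedExponents`.
  let g : (Fin (e + 2) →₀ ℕ) → Fin 2 × (Fin e → Fin (n + 1)) :=
    fun s => (Fin.ofNat 2 (s 0), fun k => Fin.ofNat (n + 1) (s k.castSucc.succ))
  have hg : Set.InjOn g (reducedExponents e n) := by
    intro s hs t ht hst
    simp only [reducedExponents, Finset.coe_filter, Finset.mem_finsuppAntidiag, Set.mem_ofPred_eq,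
      Fin.sum_univ_succ (n := e + 1), Fin.sum_univ_castSucc (n := e)] at hs ht
    obtain ⟨⟨hs1, -⟩, hs0⟩ := hs
    obtain ⟨⟨ht1, -⟩, ht0⟩ := ht
    have h0 : s 0 = t 0 := by
      have := congrArg (fun z => (z.1 : ℕ)) hst
      simp only [g, Fin.ofNat] at this
      omega
    have hk : ∀ k : Fin e, s k.castSucc.succ = t k.castSucc.succ := by
      intro k
      have := congrArg (fun z => ((z.2 k : Fin (n + 1)) : ℕ)) hst
      simp only [g, Fin.ofNat] at this
      have h1 := Finset.single_le_sum (f := fun k : Fin e => s k.castSucc.succ)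
        (fun _ _ => Nat.zero_le _) (Finset.mem_univ k)
      have h2 := Finset.single_le_sum (f := fun k : Fin e => t k.castSucc.succ)
        (fun _ _ => Nat.zero_le _) (Finset.mem_univ k)
      rwa [Nat.mod_eq_of_lt (by omega), Nat.mod_eq_of_lt (by omega)] at this
    have hsum : ∑ k : Fin e, s k.castSucc.succ = ∑ k : Fin e, t k.castSucc.succ :=
      Finset.sum_congr rfl fun k _ => hk k
    ext i
    refine Fin.cases h0 (fun i => ?_) i
    refine Fin.lastCases ?_ hk i
    omega
  calc (reducedExponents e n).card
      ≤ (Finset.univ : Finset (Fin 2 × (Fin e → Fin (n + 1)))).card :=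
        Finset.card_le_card_of_injOn g (fun _ _ => Finset.mem_coe.2 (Finset.mem_univ _)) hg
    _ = 2 * (n + 1) ^ e := by simp

theorem finrank_harmonic_le (e n : ℕ) :
    Module.Finite ℝ ↥(MvPolynomial.homogeneousSubmodule (Fin (e + 2)) ℝ n ⊓
      LinearMap.ker (polyLaplacian (e + 2))) ∧
    Module.finrank ℝ ↥(MvPolynomial.homogeneousSubmodule (Fin (e + 2)) ℝ n ⊓
      LinearMap.ker (polyLaplacian (e + 2))) ≤ 2 * (n + 1) ^ e := by
  let V := MvPolynomial.homogeneousSubmodule (Fin (e + 2)) ℝ n ⊓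
      LinearMap.ker (polyLaplacian (e + 2))
  let T : V →ₗ[ℝ] (reducedExponents e n → ℝ) :=
    LinearMap.pi fun s => (MvPolynomial.lcoeff ℝ s.1) ∘ₗ V.subtype
  have hT : Function.Injective T := by
    rw [injective_iff_map_eq_zero]
    rintro ⟨p, hp, hp'⟩ h
    have : p = 0 := by
      refine eq_zero_of_coeff_eq_zero hp' fun s hs => ?_
      by_cases hd : s.degree = n
      · refine congrFun h ⟨s, ?_⟩
        simp only [reducedExponents, Finset.mem_filter, Finset.mem_finsuppAntidiag]
        refine ⟨⟨?_, Finset.subset_univ _⟩, hs⟩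
        rw [← hd, Finsupp.degree_eq_sum]
      · exact MvPolynomial.IsHomogeneous.coeff_eq_zero hp hd
    exact Subtype.ext this
  refine ⟨Module.Finite.of_injective T hT, ?_⟩
  have := LinearMap.finrank_le_finrank_of_injective hT
  rw [Module.finrank_fintype_fun_eq_card, Fintype.card_coe] at this
  exact this.trans (card_reducedExponents_le e n)

theorem harmDim_le {d : ℕ} (hd : 2 ≤ d) (n : ℕ) : harmDim d n ≤ 2 * (n + 1) ^ (d - 2) := by
  obtain ⟨e, rfl⟩ := Nat.exists_eq_add_of_le' hd
  obtain ⟨_, h⟩ := finrank_harmonic_le e n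
  exact (Submodule.finrank_map_le _ _).trans h

/-! ## Orthogonality of spherical harmonics of different degrees -/

theorem eigen_lt_eigen {d n k : ℕ} (hd : 2 ≤ d) (h : n < k) : eigen d n < eigen d k := by
  have h2 : (2 : ℝ) ≤ d := by exact_mod_cast hd
  have h1 : (n : ℝ) < k := by exact_mod_cast h
  have h0 : (0 : ℝ) ≤ n := n.cast_nonneg
  unfold eigen
  nlinarith

theorem polyRestrict_sum_angular {d n : ℕ} {p : MvPolynomial (Fin d) ℝ}
    (hp : p.IsHomogeneous n) (hp' : polyLaplacian d p = 0) :
    ∑ i, ∑ j, polyRestrict d (angular i j (angular i j p)) =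
      (-(2 * eigen d n)) • polyRestrict d p := by
  simp only [← map_sum]
  rw [sum_angular_angular hp, hp', ← MvPolynomial.smul_eq_C_mul]
  simp

/-- Eigenvectors of a symmetric operator for different eigenvalues are orthogonal: moving one
angular derivative across on either side gives the same sum of inner products of first derivatives.
-/
theorem inner_sphHarm {d n k : ℕ} (hd : 2 ≤ d) (hnk : n ≠ k) {f g : C(Sph d, ℝ)}
    (hf : f ∈ sphHarm d n) (hg : g ∈ sphHarm d k) : inner ℝ (toL2 d f) (toL2 d g) = 0 := by
  obtain ⟨p, ⟨hp, hp'⟩, rfl⟩ := hf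
  obtain ⟨q, ⟨hq, hq'⟩, rfl⟩ := hg
  have h1 := congrArg (fun z => inner ℝ (toL2 d z) (toL2 d (polyRestrict d q)))
    (polyRestrict_sum_angular hp hp')
  have h2 := congrArg (fun z => inner ℝ (toL2 d (polyRestrict d p)) (toL2 d z))
    (polyRestrict_sum_angular hq hq')
  simp only [map_sum, sum_inner, inner_sum, map_smul, real_inner_smul_left,
    real_inner_smul_right] at h1 h2
  simp only [inner_angular _ _ (angular _ _ p) q] at h1
  simp only [← neg_eq_iff_eq_neg.2 (inner_angular _ _ p (angular _ _ q))] at h2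
  have h3 := h1.symm.trans h2
  have h4 : eigen d n ≠ eigen d k := by
    rcases hnk.lt_or_gt with h | h
    · exact (eigen_lt_eigen hd h).ne
    · exact (eigen_lt_eigen hd h).ne'
  have h5 : (eigen d n - eigen d k) *
      inner ℝ (toL2 d (polyRestrict d p)) (toL2 d (polyRestrict d q)) = 0 := by linarith
  exact (mul_eq_zero.1 h5).resolve_left (sub_ne_zero.2 h4)

theorem inner_eq_zero_of_mem_sphPoly {d ℓ : ℕ} {f : L2Sph d} {g : C(Sph d, ℝ)}
    (h : ∀ n ≤ ℓ, ∀ g ∈ sphHarm d n, inner ℝ f (toL2 d g) = 0) (hg : g ∈ sphPoly d ℓ) :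
    inner ℝ f (toL2 d g) = 0 := by
  have : sphPoly d ℓ ≤ LinearMap.ker ((innerSL ℝ f) ∘L toL2 d).toLinearMap := by
    refine iSup₂_le fun n hn g hg => ?_
    simpa using h n (by simpa [Nat.lt_succ_iff] using hn) g hg
  simpa using this hg

/-! ## Spherical polynomials are sums of spherical harmonics -/

theorem sphHarm_le_sphPoly {d n ℓ : ℕ} (h : n ≤ ℓ) : sphHarm d n ≤ sphPoly d ℓ :=
  le_iSup₂_of_le n (by simpa [Nat.lt_succ_iff] using h) le_rfl

theorem sphPoly_mono {d : ℕ} : Monotone (sphPoly d) := fun _ _ h =>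
  iSup₂_le fun _ hn => sphHarm_le_sphPoly ((Nat.lt_succ_iff.1 (Finset.mem_range.1 hn)).trans h)

theorem eval_smul_of_isHomogeneous {d n : ℕ} {p : MvPolynomial (Fin d) ℝ}
    (hp : p.IsHomogeneous n) (r : ℝ) (x : Fin d → ℝ) :
    MvPolynomial.eval (fun i => r * x i) p = r ^ n * MvPolynomial.eval x p := by
  rw [MvPolynomial.eval_eq, MvPolynomial.eval_eq, Finset.mul_sum]
  refine Finset.sum_congr rfl fun s hs => ?_
  have hn : n = ∑ i ∈ s.support, s i := hp.degree_eq_sum_deg_support hs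
  simp only [mul_pow, Finset.prod_mul_distrib]
  rw [Finset.prod_pow_eq_pow_sum, ← hn]
  ring

theorem eq_zero_of_polyRestrict_eq_zero {d n : ℕ} (hd : 2 ≤ d) {p : MvPolynomial (Fin d) ℝ}
    (hp : p.IsHomogeneous n) (h : polyRestrict d p = 0) : p = 0 := by
  have : Nonempty (Fin d) := ⟨⟨0, by omega⟩⟩
  refine MvPolynomial.funext fun x => ?_
  obtain ⟨u, hu⟩ : ∃ u : Sph d, WithLp.toLp 2 x = ‖WithLp.toLp 2 x‖ •
      (u : EuclideanSpace ℝ (Fin d)) := by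
    by_cases hx : WithLp.toLp 2 x = 0
    · obtain ⟨u, hu⟩ := (NormedSpace.sphere_nonempty
        (x := (0 : EuclideanSpace ℝ (Fin d)))).2 zero_le_one
      exact ⟨⟨u, hu⟩, by simp [hx]⟩
    · refine ⟨⟨‖WithLp.toLp 2 x‖⁻¹ • WithLp.toLp 2 x, ?_⟩, ?_⟩
      · rw [mem_sphere_zero_iff_norm, norm_smul, norm_inv, norm_norm,
          inv_mul_cancel₀ (norm_ne_zero_iff.2 hx)]
      · rw [smul_inv_smul₀ (norm_ne_zero_iff.2 hx)]
  have hx : x = fun i => ‖WithLp.toLp 2 x‖ * (u : EuclideanSpace ℝ (Fin d)) i := by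
    ext i
    exact congrArg (fun z : EuclideanSpace ℝ (Fin d) => z i) hu
  have hu' := congrArg (fun z : C(Sph d, ℝ) => z u) h
  simp only [polyRestrict_apply, ContinuousMap.zero_apply] at hu'
  rw [hx, eval_smul_of_isHomogeneous hp, hu', mul_zero, map_zero]

/-- Write `p = h + |x|²q` with `h` harmonic; on the sphere this is `h + q`, with `q` of degree lower
by 2. Solving `Δ(|x|²q) = Δp` is possible because `q ↦ Δ(|x|²q)` is an injective endomorphism of a
finite-dimensional space. -/
theorem polyRestrict_mem_sphPoly {d : ℕ} (hd : 2 ≤ d) (n : ℕ) :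
    ∀ p : MvPolynomial (Fin d) ℝ, p.IsHomogeneous n → polyRestrict d p ∈ sphPoly d n := by
  have base : ∀ n < 2, ∀ p : MvPolynomial (Fin d) ℝ, p.IsHomogeneous n →
      polyRestrict d p ∈ sphPoly d n := fun n hn p hp =>
    sphHarm_le_sphPoly le_rfl ⟨p, ⟨hp, polyLaplacian_eq_zero hp hn⟩, rfl⟩
  induction n using Nat.twoStepInduction with
  | zero => exact base 0 (by norm_num)
  | one => exact base 1 (by norm_num)
  | more n ih _ =>
    intro p hp
    let V := MvPolynomial.homogeneousSubmodule (Fin d) ℝ n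
    have : Module.Finite ℝ V := Module.Finite.iff_fg.2
      (MvPolynomial.homogeneousSubmodule_fg (σ := Fin d) (R := ℝ) n)
    have hmul : ∀ q : MvPolynomial (Fin d) ℝ, q.IsHomogeneous n →
        (normSqPoly d * q).IsHomogeneous (n + 2) := fun q hq => by
      rw [add_comm]
      exact (isHomogeneous_normSqPoly d).mul hq
    let T : V →ₗ[ℝ] V := (polyLaplacian d ∘ₗ LinearMap.mulLeft ℝ (normSqPoly d)).restrict
      fun q hq => isHomogeneous_polyLaplacian (hmul q hq)
    have hT : Function.Injective T := by
      rw [injective_iff_map_eq_zero]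
      rintro ⟨q, hq⟩ h
      have h' : polyLaplacian d (normSqPoly d * q) = 0 := congrArg Subtype.val h
      have hr : polyRestrict d (normSqPoly d * q) = polyRestrict d q := by
        rw [polyRestrict_mul, polyRestrict_normSqPoly, one_mul]
      -- If `|x|²q` is harmonic, the restriction of `q` is a harmonic of degree `n + 2`, and by
      -- induction also a sum of harmonics of degree at most `n`; it is orthogonal to itself.
      have hq1 : polyRestrict d q ∈ sphHarm d (n + 2) :=
        ⟨normSqPoly d * q, ⟨hmul q hq, h'⟩, hr⟩
      have h0 : inner ℝ (toL2 d (polyRestrict d q)) (toL2 d (polyRestrict d q)) = 0 :=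
        inner_eq_zero_of_mem_sphPoly (fun k hk g hg => inner_sphHarm hd (by omega) hq1 hg)
          (ih q hq)
      rw [inner_self_eq_zero] at h0
      exact Subtype.ext (eq_zero_of_polyRestrict_eq_zero hd hq
        (toL2_injective (h0.trans (map_zero _).symm)))
    obtain ⟨⟨q, hq⟩, hTq⟩ := LinearMap.injective_iff_surjective.1 hT
      ⟨polyLaplacian d p, isHomogeneous_polyLaplacian hp⟩
    have hTq' : polyLaplacian d (normSqPoly d * q) = polyLaplacian d p := congrArg Subtype.val hTq
    have hsplit : polyRestrict d p = polyRestrict d (p - normSqPoly d * q) + polyRestrict d q := by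
      rw [map_sub, polyRestrict_mul, polyRestrict_normSqPoly, one_mul, sub_add_cancel]
    rw [hsplit]
    refine Submodule.add_mem _ (sphHarm_le_sphPoly le_rfl
      ⟨_, ⟨MvPolynomial.IsHomogeneous.sub hp (hmul q hq), ?_⟩, rfl⟩)
      (sphPoly_mono (Nat.le_add_right n 2) (ih q hq))
    rw [SetLike.mem_coe, LinearMap.mem_ker, map_sub, hTq', sub_self]

theorem sphPoly_eq_map {d : ℕ} (hd : 2 ≤ d) (ℓ : ℕ) :
    sphPoly d ℓ = (MvPolynomial.restrictTotalDegree (Fin d) ℝ ℓ).map (polyRestrict d) := by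
  refine le_antisymm (iSup₂_le fun n hn => ?_) ?_
  · rintro _ ⟨p, ⟨hp, -⟩, rfl⟩
    refine ⟨p, ?_, rfl⟩
    rw [SetLike.mem_coe, MvPolynomial.mem_restrictTotalDegree]
    exact (MvPolynomial.IsHomogeneous.totalDegree_le hp).trans
      (Nat.lt_succ_iff.1 (Finset.mem_range.1 hn))
  · rintro _ ⟨p, hp, rfl⟩
    rw [SetLike.mem_coe, MvPolynomial.mem_restrictTotalDegree] at hp
    rw [← MvPolynomial.sum_homogeneousComponent p, map_sum]
    refine Submodule.sum_mem _ fun i hi => ?_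
    exact sphPoly_mono ((Nat.lt_succ_iff.1 (Finset.mem_range.1 hi)).trans hp)
      (polyRestrict_mem_sphPoly hd i _ (MvPolynomial.homogeneousComponent_isHomogeneous i p))

/-! ## Completeness of the spherical harmonics -/

theorem dense_range_polyRestrict (d : ℕ) : DenseRange (polyRestrict d) := by
  let A : Subalgebra ℝ C(Sph d, ℝ) :=
    (LinearMap.range (polyRestrict d)).toSubalgebra ⟨1, by ext x; simp⟩ (by
      rintro _ _ ⟨p, rfl⟩ ⟨q, rfl⟩
      exact ⟨p * q, polyRestrict_mul p q⟩)
  have hA : A.SeparatesPoints := by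
    intro x y hxy
    obtain ⟨i, hi⟩ : ∃ i, (x : EuclideanSpace ℝ (Fin d)) i ≠ (y : EuclideanSpace ℝ (Fin d)) i := by
      by_contra! h
      exact hxy (Subtype.ext (PiLp.ext h))
    exact ⟨polyRestrict d (MvPolynomial.X i), ⟨_, ⟨MvPolynomial.X i, rfl⟩, rfl⟩, by simpa using hi⟩
  have h := ContinuousMap.subalgebra_topologicalClosure_eq_top_of_separatesPoints A hA
  have h' : closure (A : Set C(Sph d, ℝ)) = Set.univ := by
    rw [← Subalgebra.topologicalClosure_coe, h]; rfl
  exact dense_iff_closure_eq.2 h'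

theorem eq_zero_of_coeff {d : ℕ} (hd : 2 ≤ d) {Y : (n : ℕ) → Fin (harmDim d n) → C(Sph d, ℝ)}
    (hY : IsHarmonicBasis d Y) {f : L2Sph d} (h : ∀ n j, coeff Y f n j = 0) : f = 0 := by
  have h1 : ∀ n, ∀ g ∈ sphHarm d n, inner ℝ f (toL2 d g) = 0 := by
    intro n g hg
    rw [← hY.span_eq n] at hg
    have : Submodule.span ℝ (Set.range (Y n)) ≤
        LinearMap.ker ((innerSL ℝ f) ∘L toL2 d).toLinearMap := by
      rw [Submodule.span_le]
      rintro _ ⟨j, rfl⟩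
      simpa [coeff] using h n j
    simpa using this hg
  have h2 : ∀ p, inner ℝ f (toL2 d (polyRestrict d p)) = 0 := fun p => by
    refine inner_eq_zero_of_mem_sphPoly (ℓ := p.totalDegree) (fun n _ => h1 n) ?_
    rw [sphPoly_eq_map hd]
    exact ⟨p, (MvPolynomial.mem_restrictTotalDegree _ _ _).2 le_rfl, rfl⟩
  have h3 : ∀ v, inner ℝ f v = 0 := by
    have hcl : IsClosed {v : L2Sph d | inner ℝ f v = 0} :=
      isClosed_eq (continuous_const.inner continuous_id) continuous_const
    have hdense : DenseRange fun p => toL2 d (polyRestrict d p) :=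
      (ContinuousMap.toLp_denseRange ℝ (sphMeasure d) ℝ (by norm_num)).comp
        (dense_range_polyRestrict d) (toL2 d).continuous
    exact fun v => hdense.induction_on v hcl h2
  exact inner_self_eq_zero.1 (h3 f)

/-! ## The sum of the squares of an orthonormal basis of spherical harmonics -/

theorem coeff_basis {d : ℕ} {Y : (n : ℕ) → Fin (harmDim d n) → C(Sph d, ℝ)}
    (hY : IsHarmonicBasis d Y) {n : ℕ} (i j : Fin (harmDim d n)) :
    coeff Y (toL2 d (Y n i)) n j = if i = j then 1 else 0 :=
  orthonormal_iff_ite.1 (hY.orthonormal n) i j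

theorem basis_mem {d : ℕ} {Y : (n : ℕ) → Fin (harmDim d n) → C(Sph d, ℝ)}
    (hY : IsHarmonicBasis d Y) (n : ℕ) (j : Fin (harmDim d n)) : Y n j ∈ sphHarm d n := by
  rw [← hY.span_eq n]
  exact Submodule.subset_span ⟨j, rfl⟩

theorem coeff_sum {d : ℕ} (Y : (n : ℕ) → Fin (harmDim d n) → C(Sph d, ℝ)) {ι : Type*}
    (s : Finset ι) (a : ι → ℝ) (f : ι → C(Sph d, ℝ)) (n : ℕ) (j : Fin (harmDim d n)) :
    coeff Y (toL2 d (∑ i ∈ s, a i • f i)) n j = ∑ i ∈ s, a i * coeff Y (toL2 d (f i)) n j := by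
  simp [coeff, sum_inner, real_inner_smul_left]

theorem coeff_sum_basis {d : ℕ} {Y : (n : ℕ) → Fin (harmDim d n) → C(Sph d, ℝ)}
    (hY : IsHarmonicBasis d Y) {n : ℕ} (a : Fin (harmDim d n) → ℝ) (j : Fin (harmDim d n)) :
    coeff Y (toL2 d (∑ i, a i • Y n i)) n j = a j := by
  rw [coeff_sum]
  simp [coeff_basis hY]

theorem eq_sum_coeff {d n : ℕ} {Y : (n : ℕ) → Fin (harmDim d n) → C(Sph d, ℝ)}
    (hY : IsHarmonicBasis d Y) {f : C(Sph d, ℝ)} (hf : f ∈ sphHarm d n) :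
    f = ∑ j, coeff Y (toL2 d f) n j • Y n j := by
  rw [← hY.span_eq n, Submodule.mem_span_range_iff_exists_fun] at hf
  obtain ⟨a, rfl⟩ := hf
  exact Finset.sum_congr rfl fun j _ => by rw [coeff_sum_basis hY]

theorem norm_sq_sum_basis {d n : ℕ} {Y : (n : ℕ) → Fin (harmDim d n) → C(Sph d, ℝ)}
    (hY : IsHarmonicBasis d Y) (a : Fin (harmDim d n) → ℝ) :
    ‖toL2 d (∑ j, a j • Y n j)‖ ^ 2 = ∑ j, a j ^ 2 := by
  rw [← real_inner_self_eq_norm_sq]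
  simp only [map_sum, map_smul]
  rw [(hY.orthonormal n).inner_sum]
  simp [sq]

theorem norm_toL2_comp_sphMap {d : ℕ}
    (R : EuclideanSpace ℝ (Fin d) ≃ₗᵢ[ℝ] EuclideanSpace ℝ (Fin d)) (f : C(Sph d, ℝ)) :
    ‖toL2 d (f.comp (sphMap R))‖ ^ 2 = ‖toL2 d f‖ ^ 2 := by
  rw [← real_inner_self_eq_norm_sq, ← real_inner_self_eq_norm_sq, inner_toL2, inner_toL2]
  exact integral_comp_sphMap R (f * f)

/-- The function `h` represents evaluation at `R x` on the harmonics of degree `n`, so `F = ‖h‖² = h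
(R x)`. Since `h ∘ R` is a harmonic of the same norm, Bessel and Cauchy–Schwarz at `x` give `F² ≤ F
* ∑ j, Y n j x ^ 2`. -/
theorem sum_sq_sphMap_le {d n : ℕ} {Y : (n : ℕ) → Fin (harmDim d n) → C(Sph d, ℝ)}
    (hY : IsHarmonicBasis d Y)
    (R : EuclideanSpace ℝ (Fin d) ≃ₗᵢ[ℝ] EuclideanSpace ℝ (Fin d)) (x : Sph d) :
    ∑ j, Y n j (sphMap R x) ^ 2 ≤ ∑ j, Y n j x ^ 2 := by
  set F := ∑ j, Y n j (sphMap R x) ^ 2 with hF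
  let h : C(Sph d, ℝ) := ∑ j, Y n j (sphMap R x) • Y n j
  have hmem : h.comp (sphMap R) ∈ sphHarm d n := comp_sphMap_mem_sphHarm R
    (Submodule.sum_mem _ fun j _ => Submodule.smul_mem _ _ (basis_mem hY n j))
  have hval : h.comp (sphMap R) x = F := by
    simp [h, hF, ContinuousMap.sum_apply, sq]
  have hbessel : ∑ j, coeff Y (toL2 d (h.comp (sphMap R))) n j ^ 2 ≤ F := by
    have := (hY.orthonormal n).sum_inner_products_le (toL2 d (h.comp (sphMap R)))
      (s := Finset.univ)
    rw [norm_toL2_comp_sphMap, norm_sq_sum_basis hY] at this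
    refine le_trans (le_of_eq (Finset.sum_congr rfl fun j _ => ?_)) this
    rw [Real.norm_eq_abs, sq_abs, real_inner_comm]; rfl
  have hexp := congrArg (fun z : C(Sph d, ℝ) => z x) (eq_sum_coeff hY hmem)
  simp only [ContinuousMap.sum_apply, ContinuousMap.smul_apply, smul_eq_mul] at hexp
  have hcs := Finset.sum_mul_sq_le_sq_mul_sq Finset.univ
    (fun j => coeff Y (toL2 d (h.comp (sphMap R))) n j) (fun j => Y n j x)
  rw [← hexp, hval] at hcs
  have hF0 : 0 ≤ F := Finset.sum_nonneg fun _ _ => sq_nonneg _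
  have hx0 : 0 ≤ ∑ j, Y n j x ^ 2 := Finset.sum_nonneg fun _ _ => sq_nonneg _
  rcases hF0.eq_or_lt with h0 | h0
  · rw [← h0]; exact hx0
  · have := hcs.trans (mul_le_mul_of_nonneg_right hbessel hx0)
    rw [sq] at this
    exact le_of_mul_le_mul_left this h0

theorem sum_sq_basis {d : ℕ} (hd : 2 ≤ d)
    {Y : (n : ℕ) → Fin (harmDim d n) → C(Sph d, ℝ)} (hY : IsHarmonicBasis d Y) (n : ℕ)
    (x : Sph d) : ∑ j, Y n j x ^ 2 = harmDim d n := by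
  have hle : ∀ x y : Sph d, ∑ j, Y n j y ^ 2 ≤ ∑ j, Y n j x ^ 2 := by
    intro x y
    -- The reflection in the hyperplane orthogonal to `x - y` takes `x` to `y`, so isometries act
    -- transitively. The sum is therefore constant, and its integral counts the basis.
    have hR := Submodule.reflection_sub (v := (x : EuclideanSpace ℝ (Fin d)))
      (w := (y : EuclideanSpace ℝ (Fin d))) (by simp)
    have hy : sphMap (Submodule.reflection
        (ℝ ∙ ((x : EuclideanSpace ℝ (Fin d)) - (y : EuclideanSpace ℝ (Fin d))))ᗮ) x = y :=
      Subtype.ext hR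
    have := sum_sq_sphMap_le (n := n) hY (Submodule.reflection
        (ℝ ∙ ((x : EuclideanSpace ℝ (Fin d)) - (y : EuclideanSpace ℝ (Fin d))))ᗮ) x
    rwa [hy] at this
  have hconst : ∀ y : Sph d, ∑ j, Y n j y ^ 2 = ∑ j, Y n j x ^ 2 := fun y =>
    le_antisymm (hle x y) (hle y x)
  have := isProbabilityMeasure_sphMeasure hd
  have hint : ∫ y, ∑ j, Y n j y ^ 2 ∂sphMeasure d = harmDim d n := by
    rw [integral_finsetSum (f := fun j y => Y n j y ^ 2) _ fun j _ =>
      integrable_continuousMap (Y n j ^ 2)]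
    have : ∀ j, ∫ y, Y n j y ^ 2 ∂sphMeasure d = 1 := by
      intro j
      have h := coeff_basis hY j j
      rw [coeff, inner_toL2, if_pos rfl] at h
      simpa [sq] using h
    simp [this]
  simp only [hconst] at hint
  simpa using hint

/-! ## Convergence of the kernel series -/

theorem eigen_zero_pow {d m : ℕ} (hm : m ≠ 0) : eigen d 0 ^ m = 0 := by
  simp [eigen, hm]

theorem eigen_pos {d n : ℕ} (hd : 2 ≤ d) (hn : 0 < n) : 0 < eigen d n := by
  have := eigen_lt_eigen hd hn
  simpa [eigen] using this

theorem eigen_pow_nonneg {d : ℕ} (hd : 2 ≤ d) (m n : ℕ) : 0 ≤ eigen d n ^ m := by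
  rcases n.eq_zero_or_pos with rfl | hn
  · simp [eigen]
  · exact (pow_pos (eigen_pos hd hn) m).le

theorem eigen_pow_pos {d n : ℕ} (hd : 2 ≤ d) (m : ℕ) (hn : 0 < n) : 0 < eigen d n ^ m :=
  pow_pos (eigen_pos hd hn) m

theorem summable_harmDim {d m : ℕ} (hd : 2 ≤ d) (hm : d ≤ 2 * m) :
    Summable fun n => (eigen d n ^ m)⁻¹ * (harmDim d n : ℝ) := by
  -- The constant comes from `2 (n+1)^(d-2) ≤ 2 (2n)^(d-2)`. At `n = 0` both series have the term 0,
  -- as the inverse of 0 is 0.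
  have hs : Summable fun n : ℕ => (2 * 2 ^ (d - 2) : ℝ) * (1 / (n : ℝ) ^ 2) :=
    (Real.summable_one_div_nat_pow.2 (by norm_num)).mul_left _
  refine Summable.of_nonneg_of_le (fun n => mul_nonneg (inv_nonneg.2 (eigen_pow_nonneg hd m n))
    (Nat.cast_nonneg _)) (fun n => ?_) hs
  rcases n.eq_zero_or_pos with rfl | hn
  · rw [eigen_zero_pow (by omega)]; simp
  have hn1 : (1 : ℝ) ≤ n := by exact_mod_cast hn
  have h2 : (2 : ℝ) ≤ d := by exact_mod_cast hd
  have h1 : (n : ℝ) ^ 2 ≤ eigen d n := by unfold eigen; nlinarith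
  have h3 : (n : ℝ) ^ (d - 2) * (n : ℝ) ^ 2 ≤ eigen d n ^ m := by
    rw [← pow_add, Nat.sub_add_cancel hd]
    calc (n : ℝ) ^ d ≤ (n : ℝ) ^ (2 * m) := pow_le_pow_right₀ hn1 hm
      _ = ((n : ℝ) ^ 2) ^ m := pow_mul _ _ _
      _ ≤ _ := pow_le_pow_left₀ (by positivity) h1 m
  have h4 : (harmDim d n : ℝ) ≤ 2 * 2 ^ (d - 2) * (n : ℝ) ^ (d - 2) := by
    calc (harmDim d n : ℝ) ≤ 2 * ((n : ℝ) + 1) ^ (d - 2) := by exact_mod_cast harmDim_le hd n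
      _ ≤ 2 * (2 * n) ^ (d - 2) := by gcongr; linarith
      _ = _ := by rw [mul_pow]; ring
  rw [inv_mul_le_iff₀ (eigen_pow_pos hd m hn), mul_one_div, ← mul_div_assoc,
    le_div_iff₀ (by positivity)]
  calc (harmDim d n : ℝ) * (n : ℝ) ^ 2
      ≤ 2 * 2 ^ (d - 2) * (n : ℝ) ^ (d - 2) * (n : ℝ) ^ 2 := by gcongr
    _ = 2 * 2 ^ (d - 2) * ((n : ℝ) ^ (d - 2) * (n : ℝ) ^ 2) := by ring
    _ ≤ 2 * 2 ^ (d - 2) * eigen d n ^ m := by gcongr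
    _ = _ := by ring

section

variable {d m ℓ : ℕ} {Y : (n : ℕ) → Fin (harmDim d n) → C(Sph d, ℝ)}

theorem abs_sum_basis_le (hd : 2 ≤ d) (hY : IsHarmonicBasis d Y) (n : ℕ) (x y : Sph d) :
    |∑ j, Y n j x * Y n j y| ≤ harmDim d n := by
  have h := Finset.sum_mul_sq_le_sq_mul_sq Finset.univ (fun j => Y n j x) (fun j => Y n j y)
  rw [sum_sq_basis hd hY, sum_sq_basis hd hY, ← sq] at h
  exact abs_le_of_sq_le_sq h (Nat.cast_nonneg _)

theorem summable_kernelTerm (hd : 2 ≤ d) (hm : d ≤ 2 * m) (hY : IsHarmonicBasis d Y)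
    (x y : Sph d) : Summable (kernelTerm m Y x y) := by
  refine Summable.of_norm_bounded (summable_harmDim hd hm) fun n => ?_
  rw [kernelTerm, norm_mul, Real.norm_of_nonneg (inv_nonneg.2 (eigen_pow_nonneg hd m n))]
  exact mul_le_mul_of_nonneg_left (abs_sum_basis_le hd hY n x y)
    (inv_nonneg.2 (eigen_pow_nonneg hd m n))

/-- With `A` and `B` the two summands on the right, Cauchy–Schwarz bounds the square of the sup norm
by `A * B ≤ (A + B)²`. Both `A` and `B` are terms of convergent series. -/
theorem norm_sum_smul_basis_le (hd : 2 ≤ d) (m : ℕ) (hY : IsHarmonicBasis d Y) {n : ℕ}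
    (hn : 0 < n) (b : Fin (harmDim d n) → ℝ) :
    ‖∑ j, b j • Y n j‖ ≤
      eigen d n ^ m * ∑ j, b j ^ 2 + (eigen d n ^ m)⁻¹ * (harmDim d n : ℝ) := by
  have hpos := eigen_pow_pos hd m hn
  have hB : 0 ≤ ∑ j, b j ^ 2 := Finset.sum_nonneg fun _ _ => sq_nonneg _
  refine (ContinuousMap.norm_le _ (by positivity)).2 fun x => ?_
  have h := Finset.sum_mul_sq_le_sq_mul_sq Finset.univ b (fun j => Y n j x)
  rw [sum_sq_basis hd hY] at h
  have hval : (∑ j, b j • Y n j) x = ∑ j, b j * Y n j x := by simp [ContinuousMap.sum_apply]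
  rw [hval, Real.norm_eq_abs]
  refine abs_le_of_sq_le_sq (h.trans ?_) (by positivity)
  have hprod : (eigen d n ^ m * ∑ j, b j ^ 2) * ((eigen d n ^ m)⁻¹ * (harmDim d n : ℝ)) =
      (∑ j, b j ^ 2) * harmDim d n := by
    field_simp
  rw [← hprod]
  have h1 : 0 ≤ eigen d n ^ m * ∑ j, b j ^ 2 := by positivity
  have h2 : 0 ≤ (eigen d n ^ m)⁻¹ * (harmDim d n : ℝ) := by positivity
  nlinarith [mul_nonneg h1 h2, sq_nonneg (eigen d n ^ m * ∑ j, b j ^ 2),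
    sq_nonneg ((eigen d n ^ m)⁻¹ * (harmDim d n : ℝ))]

/-! ## Functions with prescribed Fourier coefficients -/

theorem exists_continuous_of_coeff (hd : 2 ≤ d) (hm : d ≤ 2 * m) (hY : IsHarmonicBasis d Y)
    (b : (n : ℕ) → Fin (harmDim d n) → ℝ)
    (hb : Summable fun n => eigen d n ^ m * ∑ j, b n j ^ 2) :
    ∃ g : C(Sph d, ℝ), (∀ n j, coeff Y (toL2 d g) n j = b n j) ∧
      ∀ x, HasSum (fun n => ∑ j, b n j * Y n j x) (g x) := by
  have hs : Summable fun n => ∑ j, b n j • Y n j := by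
    refine Summable.of_norm_bounded_eventually_nat (hb.add (summable_harmDim hd hm)) ?_
    -- Degree 0 is set aside because its weight vanishes and controls nothing.
    filter_upwards [eventually_gt_atTop 0] with n hn
    exact norm_sum_smul_basis_le hd m hY hn (b n)
  obtain ⟨g, hg⟩ := hs
  refine ⟨g, fun n j => ?_, fun x => ?_⟩
  · have h1 := hg.mapL ((innerSL ℝ (toL2 d (Y n j))) ∘L toL2 d)
    -- Pairing with `Y n j` is continuous on `C(𝕊^{d-1})`, and orthogonality leaves only the block
    -- of degree `n`.
    have h2 := hasSum_single (f := fun k =>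
      ((innerSL ℝ (toL2 d (Y n j))) ∘L toL2 d) (∑ i, b k i • Y k i)) n fun k hk => by
        have hmem : ∑ i, b k i • Y k i ∈ sphHarm d k :=
          Submodule.sum_mem _ fun i _ => Submodule.smul_mem _ _ (basis_mem hY k i)
        exact inner_sphHarm hd hk.symm (basis_mem hY n j) hmem
    have h3 := h1.unique h2
    have h4 := coeff_sum_basis hY (b n) j
    rw [coeff, real_inner_comm] at h4 ⊢
    exact h3.trans h4
  · have h := hg.mapL (ContinuousMap.evalCLM ℝ x)
    simpa [ContinuousMap.sum_apply] using h

theorem mem_energySpaceL2_iff (hd : 2 ≤ d) (hm : d ≤ 2 * m) {f : L2Sph d} :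
    f ∈ energySpaceL2 hd m Y ↔ Summable fun n => eigen d n ^ m * ∑ j, coeff Y f n j ^ 2 := by
  change (Summable fun n : Set.Ioi (0 : ℕ) => eigen d n ^ m * ∑ j, coeff Y f n j ^ 2) ↔ _
  refine (summable_subtype_iff_indicator
    (f := fun n : ℕ => eigen d n ^ m * ∑ j, coeff Y f n j ^ 2)).trans ?_
  refine iff_of_eq (congrArg (fun g : ℕ → ℝ => Summable g) (Set.indicator_eq_self.2 fun n hn => ?_))
  -- The term `n = 0` may be added freely: `2 ≤ d ≤ 2m` forces `m ≠ 0`, so its weight is 0.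
  rcases n.eq_zero_or_pos with rfl | h
  · rw [Function.mem_support, eigen_zero_pow (by omega), zero_mul] at hn
    exact absurd rfl hn
  · exact h

theorem mem_energySpace_iff (hd : 2 ≤ d) (hm : d ≤ 2 * m) {f : C(Sph d, ℝ)} :
    f ∈ energySpace hd m Y ↔
      Summable fun n => eigen d n ^ m * ∑ j, coeff Y (toL2 d f) n j ^ 2 :=
  mem_energySpaceL2_iff hd hm

theorem existsUnique_toL2_eq (hd : 2 ≤ d) (hm : d ≤ 2 * m) (hY : IsHarmonicBasis d Y)
    {f : L2Sph d} (hf : f ∈ energySpaceL2 hd m Y) : ∃! g : C(Sph d, ℝ), toL2 d g = f := by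
  obtain ⟨g, hg, -⟩ := exists_continuous_of_coeff hd hm hY (coeff Y f)
    ((mem_energySpaceL2_iff hd hm).1 hf)
  have hgf : toL2 d g = f := by
    rw [← sub_eq_zero]
    refine eq_zero_of_coeff hd hY fun n j => ?_
    rw [coeff, inner_sub_left, sub_eq_zero]
    exact hg n j
  exact ⟨g, hgf, fun g' hg' => toL2_injective (hg'.trans hgf.symm)⟩

theorem eq_of_coeff_eq (hd : 2 ≤ d) (hY : IsHarmonicBasis d Y) {f g : C(Sph d, ℝ)}
    (h : ∀ n j, coeff Y (toL2 d f) n j = coeff Y (toL2 d g) n j) : f = g := by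
  refine toL2_injective ?_
  rw [← sub_eq_zero]
  refine eq_zero_of_coeff hd hY fun n j => ?_
  rw [coeff, inner_sub_left, sub_eq_zero]
  exact h n j

theorem hasSum_coeff (hd : 2 ≤ d) (hm : d ≤ 2 * m) (hY : IsHarmonicBasis d Y)
    {f : C(Sph d, ℝ)} (hf : f ∈ energySpace hd m Y) (x : Sph d) :
    HasSum (fun n => ∑ j, coeff Y (toL2 d f) n j * Y n j x) (f x) := by
  obtain ⟨g, hg, hg'⟩ := exists_continuous_of_coeff hd hm hY (coeff Y (toL2 d f))
    ((mem_energySpace_iff hd hm).1 hf)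
  obtain rfl := eq_of_coeff_eq hd hY hg
  exact hg' x

/-! ## The energy semi-inner product -/

theorem summable_energyTerm (hd : 2 ≤ d) (hm : d ≤ 2 * m) {f g : C(Sph d, ℝ)}
    (hf : f ∈ energySpace hd m Y) (hg : g ∈ energySpace hd m Y) :
    Summable (energyTerm m Y f g) := by
  rw [mem_energySpace_iff hd hm] at hf hg
  refine Summable.of_norm_bounded (hf.add hg) fun n => ?_
  rw [energyTerm, norm_mul, Real.norm_of_nonneg (eigen_pow_nonneg hd m n), ← mul_add]
  refine mul_le_mul_of_nonneg_left ?_ (eigen_pow_nonneg hd m n)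
  rw [← Finset.sum_add_distrib]
  refine (norm_sum_le _ _).trans (Finset.sum_le_sum fun j _ => ?_)
  rw [Real.norm_eq_abs, abs_le]
  constructor <;> nlinarith [sq_nonneg (coeff Y (toL2 d f) n j - coeff Y (toL2 d g) n j),
    sq_nonneg (coeff Y (toL2 d f) n j + coeff Y (toL2 d g) n j),
    sq_nonneg (coeff Y (toL2 d f) n j), sq_nonneg (coeff Y (toL2 d g) n j)]

theorem energyTerm_self_nonneg (hd : 2 ≤ d) (f : C(Sph d, ℝ)) (n : ℕ) :
    0 ≤ energyTerm m Y f f n :=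
  mul_nonneg (eigen_pow_nonneg hd m n) (Finset.sum_nonneg fun _ _ => mul_self_nonneg _)

theorem isSemiInnerProduct_energyInner (hd : 2 ≤ d) (hm : d ≤ 2 * m)
    {H : Submodule ℝ C(Sph d, ℝ)} (hH : H ≤ energySpace hd m Y) :
    IsSemiInnerProduct H (energyInner m ℓ Y) where
  symm f _ g _ := by
    simp only [energyInner, energyTerm]
    exact tsum_congr fun n => congrArg _ (Finset.sum_congr rfl fun j _ => mul_comm _ _)
  add_left f hf g hg h hh := by
    have h1 := (summable_energyTerm hd hm (hH hf) (hH hh)).subtype (Set.Ioi ℓ)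
    have h2 := (summable_energyTerm hd hm (hH hg) (hH hh)).subtype (Set.Ioi ℓ)
    rw [energyInner, energyInner, energyInner]
    refine Eq.trans ?_ (h1.tsum_add h2)
    refine tsum_congr fun n => ?_
    simp only [Function.comp_apply, energyTerm, map_add, coeff_add, add_mul,
      Finset.sum_add_distrib, mul_add]
  smul_left c f _ g _ := by
    rw [energyInner, energyInner, ← tsum_mul_left]
    refine tsum_congr fun n => ?_
    simp only [energyTerm, map_smul, coeff_smul, mul_assoc, ← Finset.mul_sum]
    ring
  nonneg f _ := tsum_nonneg fun n => energyTerm_self_nonneg hd f n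

theorem energySpaceTail_le (hd : 2 ≤ d) : energySpaceTail hd m ℓ Y ≤ energySpace hd m Y :=
  fun _ hf => hf.1

theorem coeff_eq_zero_of_energyInner_eq_zero (hd : 2 ≤ d) (hm : d ≤ 2 * m) {f : C(Sph d, ℝ)}
    (hf : f ∈ energySpace hd m Y) (h : energyInner m ℓ Y f f = 0) {n : ℕ} (hn : ℓ < n)
    (j : Fin (harmDim d n)) : coeff Y (toL2 d f) n j = 0 := by
  have hs := ((summable_energyTerm hd hm hf hf).subtype (Set.Ioi ℓ)).hasSum
  have h0 : HasSum (energyTerm m Y f f ∘ ((↑) : Set.Ioi ℓ → ℕ)) 0 := h ▸ hs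
  have hnonneg : 0 ≤ energyTerm m Y f f ∘ ((↑) : Set.Ioi ℓ → ℕ) := fun k =>
    energyTerm_self_nonneg hd f k
  have h1 : energyTerm m Y f f n = 0 :=
    congrFun ((hasSum_zero_iff_of_nonneg hnonneg).1 h0) ⟨n, hn⟩
  have h2 := (mul_eq_zero.1 h1).resolve_left
    (eigen_pow_pos hd m (Nat.zero_lt_of_lt hn)).ne'
  rw [Finset.sum_eq_zero_iff_of_nonneg fun _ _ => mul_self_nonneg _] at h2
  exact mul_self_eq_zero.1 (h2 j (Finset.mem_univ j))

theorem coeff_eq_zero_of_mem_sphPoly (hd : 2 ≤ d) (hY : IsHarmonicBasis d Y) {f : C(Sph d, ℝ)}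
    (hf : f ∈ sphPoly d ℓ) {n : ℕ} (hn : ℓ < n) (j : Fin (harmDim d n)) :
    coeff Y (toL2 d f) n j = 0 := by
  rw [coeff, real_inner_comm]
  exact inner_eq_zero_of_mem_sphPoly
    (fun k hk g hg => inner_sphHarm hd (by omega) (basis_mem hY n j) hg) hf

theorem energyInner_eq_zero_of_coeff {f g : C(Sph d, ℝ)}
    (h : ∀ n, ℓ < n → ∀ j, coeff Y (toL2 d f) n j = 0) : energyInner m ℓ Y f g = 0 := by
  rw [energyInner, ← tsum_zero (α := ℝ) (β := Set.Ioi ℓ)]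
  refine tsum_congr fun n => ?_
  simp [energyTerm, h n n.2]

theorem mem_sphPoly_iff (hd : 2 ≤ d) (hm : d ≤ 2 * m) (hY : IsHarmonicBasis d Y)
    (f : C(Sph d, ℝ)) :
    f ∈ sphPoly d ℓ ↔ f ∈ energySpace hd m Y ∧ energyInner m ℓ Y f f = 0 := by
  constructor
  · intro hf
    refine ⟨?_, energyInner_eq_zero_of_coeff fun n hn j =>
      coeff_eq_zero_of_mem_sphPoly hd hY hf hn j⟩
    rw [mem_energySpace_iff hd hm]
    refine summable_of_ne_finset_zero (s := Finset.range (ℓ + 1)) fun n hn => ?_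
    simp [coeff_eq_zero_of_mem_sphPoly hd hY hf (by simpa using hn : ℓ + 1 ≤ n)]
  · rintro ⟨hf, h0⟩
    have hf' : f = ∑ n ∈ Finset.range (ℓ + 1), ∑ j, coeff Y (toL2 d f) n j • Y n j := by
      ext x
      refine (hasSum_coeff hd hm hY hf x).unique ?_
      have : HasSum _ _ := hasSum_sum_of_ne_finset_zero (L := .unconditional ℕ)
        (s := Finset.range (ℓ + 1))
        (f := fun n => ∑ j, coeff Y (toL2 d f) n j * Y n j x) fun n hn => by
          simp [coeff_eq_zero_of_energyInner_eq_zero hd hm hf h0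
            (by simpa using hn : ℓ + 1 ≤ n)]
      simpa [ContinuousMap.sum_apply] using this
    rw [hf']
    refine Submodule.sum_mem _ fun n hn => Submodule.sum_mem _ fun j _ =>
      Submodule.smul_mem _ _ ?_
    exact sphHarm_le_sphPoly (Nat.lt_succ_iff.1 (Finset.mem_range.1 hn)) (basis_mem hY n j)

theorem finite_sphPoly (hd : 2 ≤ d) : Module.Finite ℝ (sphPoly d ℓ) := by
  rw [sphPoly_eq_map hd]
  infer_instance

end

section

variable {d m ℓ : ℕ} {Y : (n : ℕ) → Fin (harmDim d n) → C(Sph d, ℝ)}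

/-! ## Completeness of the energy semi-norm -/

/-- The weighted Fourier coefficients of degree `n > ℓ`. -/
def weightedCoeff (m ℓ : ℕ) (Y : (n : ℕ) → Fin (harmDim d n) → C(Sph d, ℝ)) (f : C(Sph d, ℝ))
    (n : ℕ) : EuclideanSpace ℝ (Fin (harmDim d n)) :=
  WithLp.toLp 2 fun j => if ℓ < n then √(eigen d n ^ m) * coeff Y (toL2 d f) n j else 0

theorem norm_weightedCoeff_sq (hd : 2 ≤ d) (f : C(Sph d, ℝ)) (n : ℕ) :
    ‖weightedCoeff m ℓ Y f n‖ ^ 2 = (Set.Ioi ℓ).indicator (energyTerm m Y f f) n := by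
  rw [EuclideanSpace.real_norm_sq_eq]
  by_cases hn : ℓ < n
  · rw [Set.indicator_of_mem (Set.mem_Ioi.2 hn), energyTerm, Finset.mul_sum]
    refine Finset.sum_congr rfl fun j _ => ?_
    simp only [weightedCoeff, if_pos hn]
    rw [mul_pow, Real.sq_sqrt (eigen_pow_nonneg hd m n), sq (coeff Y (toL2 d f) n j)]
  · rw [Set.indicator_of_notMem (by simpa using hn)]
    simp [weightedCoeff, hn]

theorem weightedCoeff_sub (f g : C(Sph d, ℝ)) (n : ℕ) :
    weightedCoeff m ℓ Y (f - g) n = weightedCoeff m ℓ Y f n - weightedCoeff m ℓ Y g n := by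
  ext j
  by_cases hn : ℓ < n
  · simp [weightedCoeff, hn, coeff, inner_sub_left, mul_sub]
  · simp [weightedCoeff, hn]

theorem memℓp_weightedCoeff (hd : 2 ≤ d) (hm : d ≤ 2 * m) {f : C(Sph d, ℝ)}
    (hf : f ∈ energySpace hd m Y) : Memℓp (weightedCoeff m ℓ Y f) 2 := by
  rw [memℓp_gen_iff (by norm_num)]
  refine ((summable_energyTerm hd hm hf hf).indicator (Set.Ioi ℓ)).congr fun n => ?_
  rw [← norm_weightedCoeff_sq hd]
  simp

theorem semiNorm_eq_norm (hd : 2 ≤ d) {f : C(Sph d, ℝ)}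
    {v : lp (fun n => EuclideanSpace ℝ (Fin (harmDim d n))) 2}
    (hv : ∀ n, v n = weightedCoeff m ℓ Y f n) : semiNorm (energyInner m ℓ Y) f = ‖v‖ := by
  rw [semiNorm, ← Real.sqrt_sq (norm_nonneg v)]
  congr 1
  have h := lp.norm_rpow_eq_tsum (p := 2) (by norm_num) v
  simp only [ENNReal.toReal_ofNat, Real.rpow_ofNat] at h
  rw [h, energyInner]
  refine (tsum_subtype (Set.Ioi ℓ) (energyTerm m Y f f)).trans (tsum_congr fun n => ?_)
  rw [hv, norm_weightedCoeff_sq hd]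

/-- `weightedCoeff` turns the semi-norm into the norm of a complete ℓ² sum. The limit is chosen in
the tail space, which the semi-norm permits since it ignores degrees up to `ℓ`; one statement thus
serves both spaces. -/
theorem exists_limit_energySpace (hd : 2 ≤ d) (hm : d ≤ 2 * m) (hY : IsHarmonicBasis d Y)
    {u : ℕ → C(Sph d, ℝ)} (hu : ∀ k, u k ∈ energySpace hd m Y)
    (hc : ∀ ε > 0, ∃ N, ∀ p ≥ N, ∀ q ≥ N, semiNorm (energyInner m ℓ Y) (u p - u q) < ε) :
    ∃ f ∈ energySpaceTail hd m ℓ Y,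
      Tendsto (fun k => semiNorm (energyInner m ℓ Y) (u k - f)) atTop (𝓝 0) := by
  let Φ : ℕ → lp (fun n => EuclideanSpace ℝ (Fin (harmDim d n))) 2 := fun k =>
    ⟨weightedCoeff m ℓ Y (u k), memℓp_weightedCoeff hd hm (hu k)⟩
  have hΦ : ∀ p q, semiNorm (energyInner m ℓ Y) (u p - u q) = dist (Φ p) (Φ q) := fun p q => by
    rw [dist_eq_norm]
    refine semiNorm_eq_norm hd fun n => ?_
    rw [weightedCoeff_sub]
    rfl
  have hcauchy : CauchySeq Φ := Metric.cauchySeq_iff.2 fun ε hε => by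
    obtain ⟨N, hN⟩ := hc ε hε
    exact ⟨N, fun p hp q hq => hΦ p q ▸ hN p hp q hq⟩
  obtain ⟨v, hv⟩ := cauchySeq_tendsto_of_complete hcauchy
  have hv0 : ∀ n, n ≤ ℓ → v n = 0 := by
    intro n hn
    have h1 : Tendsto (fun k => ‖Φ k - v‖) atTop (𝓝 0) := tendsto_iff_norm_sub_tendsto_zero.1 hv
    have h2 : ∀ k, ‖v n‖ ≤ ‖Φ k - v‖ := fun k => by
      have := lp.norm_apply_le_norm (p := 2) (by norm_num) (Φ k - v) n
      have hz : Φ k n = 0 := by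
        ext j
        simp [Φ, weightedCoeff, hn.not_gt]
      rwa [lp.coeFn_sub, Pi.sub_apply, hz, zero_sub, norm_neg] at this
    exact norm_le_zero_iff.1 (ge_of_tendsto' h1 h2)
  -- Undo the weights. The division is genuine for `n > ℓ`, and for `n ≤ ℓ` the vector `v n` is 0.
  let b : (n : ℕ) → Fin (harmDim d n) → ℝ := fun n j => (√(eigen d n ^ m))⁻¹ * v n j
  have hb0 : ∀ n, n ≤ ℓ → ∀ j, b n j = 0 := fun n hn j => by simp [b, hv0 n hn]
  have hbv : ∀ n j, ℓ < n → √(eigen d n ^ m) * b n j = v n j := fun n j hn =>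
    mul_inv_cancel_left₀ (Real.sqrt_pos.2 (eigen_pow_pos hd m (Nat.zero_lt_of_lt hn))).ne' _
  have hbs : Summable fun n => eigen d n ^ m * ∑ j, b n j ^ 2 := by
    have h := (memℓp_gen_iff (p := 2) (by norm_num)).1 v.2
    refine h.congr fun n => ?_
    simp only [ENNReal.toReal_ofNat, Real.rpow_ofNat]
    rw [EuclideanSpace.real_norm_sq_eq, Finset.mul_sum]
    refine Finset.sum_congr rfl fun j _ => ?_
    rcases le_or_gt n ℓ with hn | hn
    · simp [hb0 n hn, hv0 n hn]
    · rw [← hbv n j hn, mul_pow, Real.sq_sqrt (eigen_pow_nonneg hd m n)]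
  obtain ⟨f, hf, -⟩ := exists_continuous_of_coeff hd hm hY b hbs
  have hfm : f ∈ energySpace hd m Y := by
    rw [mem_energySpace_iff hd hm]
    simpa only [hf] using hbs
  refine ⟨f, ⟨hfm, fun n hn j => (hf n j).trans (hb0 n hn j)⟩, ?_⟩
  refine (tendsto_iff_norm_sub_tendsto_zero.1 hv).congr fun k => Eq.symm ?_
  refine semiNorm_eq_norm hd fun n => ?_
  rw [weightedCoeff_sub, lp.coeFn_sub, Pi.sub_apply]
  congr 1
  ext j
  rcases le_or_gt n ℓ with hn | hn
  · simp [weightedCoeff, hn.not_gt, hv0 n hn]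
  · simp [weightedCoeff, hn, hf, hbv n j hn]

theorem isSemiHilbert_energySpace (hd : 2 ≤ d) (hm : d ≤ 2 * m) (hY : IsHarmonicBasis d Y) :
    IsSemiHilbert (energySpace hd m Y) (energyInner m ℓ Y) (sphPoly d ℓ) where
  semiInner := isSemiInnerProduct_energyInner hd hm le_rfl
  mem_kernel_iff := mem_sphPoly_iff hd hm hY
  finite_kernel := finite_sphPoly hd
  complete u hu hc := by
    obtain ⟨f, hf, h⟩ := exists_limit_energySpace hd hm hY hu hc
    exact ⟨f, hf.1, h⟩

theorem isSemiHilbert_energySpaceTail (hd : 2 ≤ d) (hm : d ≤ 2 * m) (hY : IsHarmonicBasis d Y) :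
    IsSemiHilbert (energySpaceTail hd m ℓ Y) (energyInner m ℓ Y) ⊥ where
  semiInner := isSemiInnerProduct_energyInner hd hm (energySpaceTail_le hd)
  mem_kernel_iff f := by
    constructor
    · rintro rfl
      exact ⟨Submodule.zero_mem _, energyInner_eq_zero_of_coeff fun n _ j => by simp [coeff]⟩
    · rintro ⟨hf, h0⟩
      refine eq_of_coeff_eq hd hY fun n j => ?_
      have : coeff Y (toL2 d f) n j = 0 := by
        rcases le_or_gt n ℓ with hn | hn
        · exact hf.2 n hn j
        · exact coeff_eq_zero_of_energyInner_eq_zero hd hm hf.1 h0 hn j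
      rw [this]
      simp [coeff]
  finite_kernel := inferInstance
  complete u hu hc := exists_limit_energySpace hd hm hY (fun k => (hu k).1) hc

/-! ## The reproducing properties of the kernel -/

theorem splineKernel_symm (x y : Sph d) : splineKernel m ℓ Y x y = splineKernel m ℓ Y y x := by
  simp only [splineKernel, kernelTerm]
  exact tsum_congr fun n => congrArg _ (Finset.sum_congr rfl fun j _ => mul_comm _ _)

theorem exists_kernel_section (hd : 2 ≤ d) (hm : d ≤ 2 * m) (hY : IsHarmonicBasis d Y)
    (y : Sph d) :
    ∃ k ∈ energySpaceTail hd m ℓ Y, (∀ x, k x = splineKernel m ℓ Y x y) ∧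
      ∀ f ∈ energySpace hd m Y, energyInner m ℓ Y f k =
        f y - (∑ n ∈ Finset.range (ℓ + 1), ∑ j, coeff Y (toL2 d f) n j • Y n j) y := by
  let b : (n : ℕ) → Fin (harmDim d n) → ℝ := fun n j =>
    if ℓ < n then (eigen d n ^ m)⁻¹ * Y n j y else 0
  -- By `sum_sq_basis` the energy of the kernel section in degree `n > ℓ` is exactly `(eigen d n ^
  -- m)⁻¹ * harmDim d n`.
  have hbs : Summable fun n => eigen d n ^ m * ∑ j, b n j ^ 2 := by
    refine ((summable_harmDim hd hm).indicator (Set.Ioi ℓ)).congr fun n => ?_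
    by_cases hn : ℓ < n
    · have hpos := eigen_pow_pos hd m (Nat.zero_lt_of_lt hn)
      rw [Set.indicator_of_mem (Set.mem_Ioi.2 hn)]
      simp only [b, if_pos hn, mul_pow]
      rw [← Finset.mul_sum, sum_sq_basis hd hY]
      field_simp
    · rw [Set.indicator_of_notMem (by simpa using hn)]
      simp [b, hn]
  obtain ⟨k, hk, hk'⟩ := exists_continuous_of_coeff hd hm hY b hbs
  refine ⟨k, ⟨?_, fun n hn j => ?_⟩, fun x => ?_, fun f hf => ?_⟩
  · rw [mem_energySpace_iff hd hm]
    simpa only [hk] using hbs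
  · simp [hk, b, hn.not_gt]
  · refine (hk' x).tsum_eq.symm.trans (Eq.trans ?_
      (tsum_subtype (Set.Ioi ℓ) (kernelTerm m Y x y)).symm)
    refine tsum_congr fun n => ?_
    by_cases hn : ℓ < n
    · rw [Set.indicator_of_mem (Set.mem_Ioi.2 hn), kernelTerm, Finset.mul_sum]
      refine Finset.sum_congr rfl fun j _ => ?_
      simp only [b, if_pos hn]
      ring
    · rw [Set.indicator_of_notMem (by simpa using hn)]
      simp [b, hn]
  -- The pairing cancels the weights and leaves the Fourier series of `f` at `y` without its degrees
  -- up to `ℓ`.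
  · have h1 := hasSum_coeff hd hm hY hf y
    have h2 : HasSum _ _ := hasSum_sum_of_ne_finset_zero (L := .unconditional ℕ)
      (s := Finset.range (ℓ + 1))
      (f := (Set.Iic ℓ).indicator fun n => ∑ j, coeff Y (toL2 d f) n j * Y n j y) fun n hn =>
        Set.indicator_of_notMem (fun h => hn (Finset.mem_range.2
          (Nat.lt_succ_of_le (Set.mem_Iic.1 h)))) _
    have h3 := (h1.sub h2).tsum_eq
    have h4 : energyInner m ℓ Y f k = _ := tsum_subtype (Set.Ioi ℓ) (energyTerm m Y f k)
    rw [h4]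
    refine Eq.trans (tsum_congr fun n => ?_) (h3.trans (congrArg (f y - ·) ?_))
    · by_cases hn : ℓ < n
      · have hpos := eigen_pow_pos hd m (Nat.zero_lt_of_lt hn)
        rw [Set.indicator_of_mem (Set.mem_Ioi.2 hn),
          Set.indicator_of_notMem (by simpa using hn), sub_zero, energyTerm, Finset.mul_sum]
        refine Finset.sum_congr rfl fun j _ => ?_
        simp only [hk, b, if_pos hn]
        field_simp
      · rw [Set.indicator_of_notMem (by simpa using hn),
          Set.indicator_of_mem (by simpa using hn), sub_self]
    · rw [ContinuousMap.sum_apply]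
      refine Finset.sum_congr rfl fun n hn => ?_
      rw [Set.indicator_of_mem (Set.mem_Iic.2 (Nat.lt_succ_iff.1 (Finset.mem_range.1 hn)))]
      simp [ContinuousMap.sum_apply]

theorem isReproducingKernel_splineKernel (hd : 2 ≤ d) (hm : d ≤ 2 * m)
    (hY : IsHarmonicBasis d Y) :
    IsReproducingKernel (energySpaceTail hd m ℓ Y) (energyInner m ℓ Y) (splineKernel m ℓ Y) where
  hilbert := isSemiHilbert_energySpaceTail hd hm hY
  reproduces y := by
    obtain ⟨k, hk, hkK, hkf⟩ := exists_kernel_section (ℓ := ℓ) hd hm hY y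
    refine ⟨k, hk, hkK, fun f hf => ?_⟩
    rw [hkf f hf.1, Finset.sum_eq_zero fun n hn => Finset.sum_eq_zero fun j _ => ?_]
    · simp
    · rw [hf.2 n (Nat.lt_succ_iff.1 (Finset.mem_range.1 hn)), zero_smul]

theorem energyInner_sum_right (hd : 2 ≤ d) (hm : d ≤ 2 * m) {f : C(Sph d, ℝ)}
    (hf : f ∈ energySpace hd m Y) {ι : Type*} (s : Finset ι) (a : ι → ℝ) {g : ι → C(Sph d, ℝ)}
    (hg : ∀ i, g i ∈ energySpace hd m Y) :
    energyInner m ℓ Y f (∑ i ∈ s, a i • g i) = ∑ i ∈ s, a i * energyInner m ℓ Y f (g i) := by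
  have hs : ∀ i ∈ s, Summable fun n : Set.Ioi ℓ => a i * energyTerm m Y f (g i) n := fun i _ =>
    ((summable_energyTerm hd hm hf (hg i)).subtype (Set.Ioi ℓ)).mul_left (a i)
  simp only [energyInner, ← tsum_mul_left]
  rw [← Summable.tsum_finsetSum hs]
  refine tsum_congr fun n => ?_
  simp only [energyTerm, coeff_sum, Finset.mul_sum]
  rw [Finset.sum_comm]
  exact Finset.sum_congr rfl fun i _ => Finset.sum_congr rfl fun j _ => by ring

theorem isSemiReproducingKernel_splineKernel (hd : 2 ≤ d) (hm : d ≤ 2 * m)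
    (hY : IsHarmonicBasis d Y) :
    IsSemiReproducingKernel (energySpace hd m Y) (energyInner m ℓ Y) (sphPoly d ℓ)
      (splineKernel m ℓ Y) where
  semiHilbert := isSemiHilbert_energySpace hd hm hY
  symm := splineKernel_symm
  reproduces n x a hxa := by
    choose k hk hkK hkf using exists_kernel_section (ℓ := ℓ) hd hm hY
    refine ⟨∑ i, a i • k (x i), Submodule.sum_mem _ fun i _ =>
      Submodule.smul_mem _ _ (hk (x i)).1, fun y => ?_, fun f hf => ?_⟩
    · simp [ContinuousMap.sum_apply, hkK]
    · have hP : (∑ n ∈ Finset.range (ℓ + 1), ∑ j, coeff Y (toL2 d f) n j • Y n j) ∈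
          sphPoly d ℓ :=
        Submodule.sum_mem _ fun n hn => Submodule.sum_mem _ fun j _ => Submodule.smul_mem _ _
          (sphHarm_le_sphPoly (Nat.lt_succ_iff.1 (Finset.mem_range.1 hn)) (basis_mem hY n j))
      rw [energyInner_sum_right hd hm hf _ _ fun i => (hk (x i)).1]
      simp only [hkf _ f hf, mul_sub, Finset.sum_sub_distrib]
      -- The defect in the reproducing formula is the increment applied to the projection of `f` to
      -- degrees at most `ℓ`, which is 0.
      rw [hxa.2 _ hP, sub_zero]

end

end SphereSpline

end

/-- For `ℓ ≥ 0` and `2m ≥ d ≥ 2`: the space `F_m^d` consists of continuous functions, the series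
defining the energy semi-inner product and the kernel converge, the kernel is the reproducing kernel
of the functions in `F_m^d` without harmonics of degree at most `ℓ`, and it is a semi-reproducing
kernel for `F_m^d` with respect to the space of spherical polynomials of degree at most `ℓ`. -/
theorem lemma3p2 (d m ℓ : ℕ) (hd : 2 ≤ d) (hm : d ≤ 2 * m)
    (Y : (n : ℕ) → Fin (SphereSpline.harmDim d n) → C(SphereSpline.Sph d, ℝ))
    (hY : SphereSpline.IsHarmonicBasis d Y) :
    (∀ f ∈ SphereSpline.energySpaceL2 hd m Y,
      ∃! g : C(SphereSpline.Sph d, ℝ), SphereSpline.toL2 d g = f) ∧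
    (∀ f ∈ SphereSpline.energySpace hd m Y, ∀ g ∈ SphereSpline.energySpace hd m Y,
      Summable fun n : Set.Ioi ℓ => SphereSpline.energyTerm m Y f g n) ∧
    (∀ x y : SphereSpline.Sph d,
      Summable fun n : Set.Ioi ℓ => SphereSpline.kernelTerm m Y x y n) ∧
    SphereSpline.sphPoly d ℓ =
      (MvPolynomial.restrictTotalDegree (Fin d) ℝ ℓ).map (SphereSpline.polyRestrict d) ∧
    SphereSpline.IsReproducingKernel (SphereSpline.energySpaceTail hd m ℓ Y)
      (SphereSpline.energyInner m ℓ Y) (SphereSpline.splineKernel m ℓ Y) ∧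
    SphereSpline.IsSemiReproducingKernel (SphereSpline.energySpace hd m Y)
      (SphereSpline.energyInner m ℓ Y) (SphereSpline.sphPoly d ℓ)
      (SphereSpline.splineKernel m ℓ Y) := by
  exact ⟨fun _ hf => SphereSpline.existsUnique_toL2_eq hd hm hY hf,
    fun _ hf _ hg => (SphereSpline.summable_energyTerm hd hm hf hg).subtype _,
    fun x y => (SphereSpline.summable_kernelTerm hd hm hY x y).subtype _,
    SphereSpline.sphPoly_eq_map hd ℓ,
    SphereSpline.isReproducingKernel_splineKernel hd hm hY,
    SphereSpline.isSemiReproducingKernel_splineKernel hd hm hY⟩
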